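/- Let $\Lambda^\vee$ be a lattice (a free abelian group of finite rank) in $\mathfrak t=\Lambda^\vee\otimes\mathbb R$, let $J$ be an integral bilinear form on $\Lambda^\vee$ and let $I=J+J^t$ be the associated even symmetric form (not assumed unimodular or nondegenerate). Write $\Lambda=\mathrm{Hom}(\Lambda^\vee,\mathbb Z)$, $T=\mathfrak t/\Lambda^\vee$, $\widehat T=\mathrm{Hom}(T,U(1))$. Crossed modules $\psi:G_1\to G_0$ have right actions, and $\mathcal S(\psi)$ is the strict categorical group with objects $G_0$, arrows $(x,\alpha):x\to x\,\psi(\alpha)$ and tensor product $(x,\alpha)(y,\beta)=(xy,\alpha^y\beta)$. The categorical torus is $\mathcal T=\mathcal S(\Theta)$, where $\Theta:\Lambda^\vee\times U(1)\to\mathfrak t$, $(m,z)\mapsto m$, with $(m,z)^x=(m,z\,e^{2\pi iJ(m,x)})$. For a crossed module $\Psi=(\psi:G_1\to G_0)$ of Lie groups, with $\psi(\alpha)$ written $\underline\alpha$, a weak endomorphism consists of pointed maps $f_i:G_i\to G_i$ and a map $\kappa:G_0\times G_0\to G_1$ with (i) $f_0(\underline\alpha)=\underline{f_1(\alpha)}$;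 (ii) $f_0(x)f_0(y)\underline{\kappa_{x,y}}=f_0(xy)$; (iii) $f_1(\alpha)f_1(\beta)\kappa_{\underline\alpha,\underline\beta}=f_1(\alpha\beta)$; (iv) $\kappa_{x,y}^{f_0(z)}\kappa_{xy,z}=\kappa_{y,z}\kappa_{x,yz}$; (v) $f_1(\alpha)^{f_0(x)}\kappa_{\underline\alpha,x}=f_1(\alpha^x)\kappa_{x,\underline{\alpha^x}}$. All maps are required to be smooth, or alternatively all are required to be real analytic; the theorem holds in either setting. Weak endomorphisms compose by $(f,\kappa)(g,\gamma)=(f\circ g,\beta)$, $\beta_{x,y}=f_1(\gamma_{x,y})\,\kappa_{g_0(x),g_0(y)}^{f_0(\underline{\gamma_{x,y}})}\,\kappa_{g_0(x)g_0(y),\underline{\gamma_{x,y}}}$. Let $wAct^+(\Psi)_0$ be the group of invertible weak endomorphisms with $f_1|_{\ker\psi}=\mathrm{id}$, and $wAct^+(\Psi)_1$ the group of invertible elements of the monoid of pointed maps $\eta:G_0\to G_1$ with product $(\eta_1\circ\eta_2)(x)=\eta_2(x)\,\eta_1(x\,\underline{\eta_2(x)})$. They form a crossed module $wAct^+(\Psi)$,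 whose structure map sends $\eta$ to $f_0(x)=x\,\underline{\eta(x)}$, $f_1(\alpha)=\alpha\,\eta(\underline\alpha)$, $\kappa_{x,y}=\eta(y)^{-1}(\eta(x)^y)^{-1}\eta(xy)$, and whose action is $\eta^{(f,\kappa)}(x)=f_1^{-1}\bigl(\eta(f_0(x))\bigr)\,\gamma_{f_0(x),\underline{\eta(f_0(x))}}$, where $(f^{-1},\gamma)=(f,\kappa)^{-1}$. The categorical group of centre-preserving weak automorphisms of $\mathcal S(\Psi)$ is $\mathcal Aut^+(\mathcal S(\Psi))=\mathcal S(wAct^+(\Psi))$. Let $O(\Lambda^\vee,I)$ be the isometry group, let $\widetilde{O(\Lambda^\vee,I)}$ be the group of pairs $(f,B)$ with $f\in O(\Lambda^\vee,I)$ and $B$ an integral bilinear form on $\Lambda^\vee$ such that $B-B^t=J-f^*J$, with product $(f,B)(g,C)=(fg,g^*B+C)$, and let $(\Gamma_2\Lambda)_{ev}$ be its normal subgroup of pairs $(\mathrm{id},B)$ with $B$ symmetric and even. Put $E=\widetilde{O(\Lambda^\vee,I)}/(\Gamma_2\Lambda)_{ev}$ and let $\Xi$ be the crossed module $\Lambda\to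 E$, $\lambda\mapsto(\mathrm{id},[\lambda\otimes\lambda])$, where $(f,B)$ acts on $\Lambda$ via $f^*$. **Theorem.** The categorical groups $\mathcal Aut^+(\mathcal T)=\mathcal S(wAct^+(\Theta))$ and $\mathcal S(\Xi)$ are equivalent (by a monoidal equivalence). Moreover, $\pi_0(\mathcal Aut^+(\mathcal T))\cong O(\Lambda^\vee,I)$, the class of $(f,\kappa)$ going to $f_0|_{\Lambda^\vee}$, and $\pi_1(\mathcal Aut^+(\mathcal T))\cong\widehat T$, where $\eta:\mathfrak t\to\Lambda^\vee\times U(1)$ corresponds to the character $\chi$ of $T$ with $\eta(x)=(0,\chi([x]))$; and $\widehat T\cong\Lambda$, with $\lambda\in\Lambda$ corresponding to the character $[x]\mapsto e^{2\pi i\lambda(x)}$. -/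

import Mathlib

set_option linter.unusedSimpArgs false

open CategoryTheory MonoidalCategory
open scoped Manifold ContDiff

universe u v

/-! ### Crossed modules and strict categorical groups -/

/-- A crossed module `bd : G₁ → G₀`, with `G₀` acting on `G₁` from the right, `act α x = α ^ x`. -/
@[ext]
structure CrossedModule (G₀ : Type u) (G₁ : Type v) [Group G₀] [Group G₁] where
  bd : G₁ →* G₀
  act : G₁ → G₀ → G₁
  act_one : ∀ α, act α 1 = α
  act_mul : ∀ α x y, act α (x * y) = act (act α x) y
  mul_act : ∀ α β x, act (α * β) x = act α x * act β x
  bd_act : ∀ α x, bd (act α x) = x⁻¹ * bd α * x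
  peiffer : ∀ α β, act β (bd α) = α⁻¹ * β * α

namespace CrossedModule

variable {G₀ : Type u} {G₁ : Type v} [Group G₀] [Group G₁] (Ψ : CrossedModule G₀ G₁)

theorem one_act (x : G₀) : Ψ.act 1 x = 1 := by
  have h := Ψ.mul_act 1 1 x
  rw [one_mul] at h
  exact left_eq_mul.mp h

theorem inv_act (α : G₁) (x : G₀) : Ψ.act α⁻¹ x = (Ψ.act α x)⁻¹ := by
  apply eq_inv_of_mul_eq_one_left
  rw [← Ψ.mul_act, inv_mul_cancel, Ψ.one_act]

theorem mul_bd_act (α : G₁) (x : G₀) : x * Ψ.bd (Ψ.act α x) = Ψ.bd α * x := by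
  rw [Ψ.bd_act]; group

theorem mul_act_bd (α β : G₁) : α * Ψ.act β (Ψ.bd α) = β * α := by
  rw [Ψ.peiffer]; group

/-- The crossed module obtained by shrinking `G₀` to a subgroup through which `bd` factors. -/
def restrict (H : Subgroup G₀) (hH : ∀ α, Ψ.bd α ∈ H) : CrossedModule H G₁ where
  bd := Ψ.bd.codRestrict H hH
  act α x := Ψ.act α x
  act_one α := Ψ.act_one α
  act_mul α x y := Ψ.act_mul α x y
  mul_act α β x := Ψ.mul_act α β x
  bd_act α x := Subtype.ext (Ψ.bd_act α x)
  peiffer α β := Ψ.peiffer α β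

/-- The underlying type of the strict categorical group `𝒮(Ψ)`: its objects are the elements
of `G₀`. -/
@[ext]
structure CatGroup (Ψ : CrossedModule G₀ G₁) where
  of : G₀

namespace CatGroup

variable {Ψ}

/-- The arrows of `𝒮(Ψ)` are the pairs `(x, α)`, with source `x` and target `x * bd α`; the
composite of `(x, α)` and `(x * bd α, β)` is `(x, α * β)`. -/
instance : Groupoid (CatGroup Ψ) where
  Hom x y := {α : G₁ // x.of * Ψ.bd α = y.of}
  id x := ⟨1, by simp⟩
  comp a b := ⟨a.1 * b.1, by rw [map_mul, ← mul_assoc, a.2, b.2]⟩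
  inv a := ⟨a.1⁻¹, by rw [map_inv, mul_inv_eq_iff_eq_mul]; exact a.2.symm⟩
  id_comp a := Subtype.ext (one_mul _)
  comp_id a := Subtype.ext (mul_one _)
  assoc a b c := Subtype.ext (mul_assoc _ _ _)
  inv_comp a := Subtype.ext (inv_mul_cancel _)
  comp_inv a := Subtype.ext (mul_inv_cancel _)

/-- The label `α` of an arrow `(x, α)`. -/
def label {x y : CatGroup Ψ} (a : x ⟶ y) : G₁ := a.1

@[ext]
theorem hom_ext {x y : CatGroup Ψ} {a b : x ⟶ y} (h : label a = label b) : a = b := Subtype.ext h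

theorem of_mul_bd_label {x y : CatGroup Ψ} (a : x ⟶ y) : x.of * Ψ.bd (label a) = y.of := a.2

/-- The arrow with a given label. -/
def homMk {x y : CatGroup Ψ} (α : G₁) (h : x.of * Ψ.bd α = y.of) : x ⟶ y := ⟨α, h⟩

@[simp] theorem label_homMk {x y : CatGroup Ψ} (α : G₁) (h : x.of * Ψ.bd α = y.of) :
    label (homMk α h : x ⟶ y) = α := rfl

@[simp] theorem label_id (x : CatGroup Ψ) : label (𝟙 x) = 1 := rfl

@[simp] theorem label_comp {x y z : CatGroup Ψ} (a : x ⟶ y) (b : y ⟶ z) :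
    label (a ≫ b) = label a * label b := rfl

/-- The isomorphism with label `1` between two objects that are equal. -/
def isoOfEq {x y : CatGroup Ψ} (h : x.of = y.of) : x ≅ y where
  hom := homMk 1 (by simp [h])
  inv := homMk 1 (by simp [h])
  hom_inv_id := by ext; simp
  inv_hom_id := by ext; simp

@[simp] theorem label_isoOfEq_hom {x y : CatGroup Ψ} (h : x.of = y.of) :
    label (isoOfEq h).hom = 1 := rfl

@[simp] theorem label_isoOfEq_inv {x y : CatGroup Ψ} (h : x.of = y.of) :
    label (isoOfEq h).inv = 1 := rfl

/-- The product of arrows in the semi-direct product `G₀ ⋉ G₁`: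
`(x, α) (y, β) = (x * y, α ^ y * β)`. -/
def tensor {x x' y y' : CatGroup Ψ} (a : x ⟶ x') (b : y ⟶ y') :
    (⟨x.of * y.of⟩ : CatGroup Ψ) ⟶ ⟨x'.of * y'.of⟩ :=
  homMk (Ψ.act (label a) y.of * label b) (by
    rw [map_mul, ← of_mul_bd_label a, ← of_mul_bd_label b, Ψ.bd_act]; group)

@[simp] theorem label_tensor {x x' y y' : CatGroup Ψ} (a : x ⟶ x') (b : y ⟶ y') :
    label (tensor a b) = Ψ.act (label a) y.of * label b := rfl

instance : MonoidalCategoryStruct (CatGroup Ψ) where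
  tensorObj x y := ⟨x.of * y.of⟩
  tensorUnit := ⟨1⟩
  tensorHom a b := tensor a b
  whiskerLeft x _ _ b := tensor (𝟙 x) b
  whiskerRight a y := tensor a (𝟙 y)
  associator _ _ _ := isoOfEq (mul_assoc _ _ _)
  leftUnitor _ := isoOfEq (one_mul _)
  rightUnitor _ := isoOfEq (mul_one _)

@[simp] theorem of_tensorObj (x y : CatGroup Ψ) : (x ⊗ y).of = x.of * y.of := rfl
@[simp] theorem of_tensorUnit : (𝟙_ (CatGroup Ψ)).of = 1 := rfl
@[simp] theorem label_tensorHom {x x' y y' : CatGroup Ψ} (a : x ⟶ x') (b : y ⟶ y') :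
    label (a ⊗ₘ b) = Ψ.act (label a) y.of * label b := rfl
@[simp] theorem label_whiskerLeft (x : CatGroup Ψ) {y y' : CatGroup Ψ} (b : y ⟶ y') :
    label (x ◁ b) = label b := by
  change Ψ.act 1 y.of * label b = _
  rw [one_act, one_mul]
@[simp] theorem label_whiskerRight {x x' : CatGroup Ψ} (a : x ⟶ x') (y : CatGroup Ψ) :
    label (a ▷ y) = Ψ.act (label a) y.of := by
  change Ψ.act (label a) y.of * 1 = _
  rw [mul_one]
@[simp] theorem label_associator_hom (x y z : CatGroup Ψ) : label (α_ x y z).hom = 1 := rfl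
@[simp] theorem label_leftUnitor_hom (x : CatGroup Ψ) : label (λ_ x).hom = 1 := rfl
@[simp] theorem label_rightUnitor_hom (x : CatGroup Ψ) : label (ρ_ x).hom = 1 := rfl

/-- The strict monoidal structure on `𝒮(Ψ)` given by the group multiplications. -/
instance : MonoidalCategory (CatGroup Ψ) := MonoidalCategory.ofTensorHom
  (id_tensorHom_id := fun x y => by ext; simp [one_act])
  (id_tensorHom := fun x _ _ b => by ext; simp [one_act])
  (tensorHom_id := fun a y => by ext; simp)
  (tensorHom_comp_tensorHom := fun {x₁ y₁ z₁ x₂ y₂ z₂} a₁ a₂ b₁ b₂ => by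
    ext
    have h := of_mul_bd_label a₂
    simp only [label_comp, label_tensorHom, Ψ.mul_act, ← h, Ψ.act_mul, Ψ.peiffer]
    group)
  (associator_naturality := fun a b c => by
    ext
    simp [Ψ.mul_act, Ψ.act_mul, mul_assoc])
  (leftUnitor_naturality := fun a => by ext; simp [one_act])
  (rightUnitor_naturality := fun a => by ext; simp [Ψ.act_one])
  (pentagon := fun x y z w => by ext; simp [one_act])
  (triangle := fun x y => by ext; simp [one_act])

end CatGroup

end CrossedModule

/-! ### Weak automorphisms of crossed modules of Lie groups -/

section LieCrossedModule

variable {E₀ H₀ E₁ H₁ : Type*} [NormedAddCommGroup E₀] [NormedSpace ℝ E₀] [TopologicalSpace H₀]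
  [NormedAddCommGroup E₁] [NormedSpace ℝ E₁] [TopologicalSpace H₁]

/-- A crossed module of Lie groups of class `C^n` (so smooth for `n = ∞`, real analytic for
`n = ω`). -/
structure LieCrossedModule (n : WithTop ℕ∞) (I₀ : ModelWithCorners ℝ E₀ H₀) (G₀ : Type u)
    [Group G₀] [TopologicalSpace G₀] [ChartedSpace H₀ G₀] [LieGroup I₀ n G₀]
    (I₁ : ModelWithCorners ℝ E₁ H₁) (G₁ : Type v)
    [Group G₁] [TopologicalSpace G₁] [ChartedSpace H₁ G₁] [LieGroup I₁ n G₁]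
    extends CrossedModule G₀ G₁ where
  contMDiff_bd : ContMDiff I₁ I₀ n bd
  contMDiff_act : ContMDiff (I₁.prod I₀) I₁ n fun p : G₁ × G₀ => act p.1 p.2

variable {n : WithTop ℕ∞} {I₀ : ModelWithCorners ℝ E₀ H₀} {G₀ : Type u}
  [Group G₀] [TopologicalSpace G₀] [ChartedSpace H₀ G₀] [LieGroup I₀ n G₀]
  {I₁ : ModelWithCorners ℝ E₁ H₁} {G₁ : Type v}
  [Group G₁] [TopologicalSpace G₁] [ChartedSpace H₁ G₁] [LieGroup I₁ n G₁]

/-- The weak endomorphisms `(f, κ)` of `Ψ`, given by pointed `C^n` maps `f₀`, `f₁` and a `C^n`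
map `κ : G₀ × G₀ → G₁`: compatibility with `bd`, the two Künneth axioms, the cocycle axiom and
equivariance. -/
@[ext]
structure WeakEnd (Ψ : LieCrossedModule n I₀ G₀ I₁ G₁) where
  f₀ : G₀ → G₀
  f₁ : G₁ → G₁
  κ : G₀ → G₀ → G₁
  contMDiff_f₀ : ContMDiff I₀ I₀ n f₀
  contMDiff_f₁ : ContMDiff I₁ I₁ n f₁
  contMDiff_κ : ContMDiff (I₀.prod I₀) I₁ n fun p : G₀ × G₀ => κ p.1 p.2
  f₀_one : f₀ 1 = 1
  f₁_one : f₁ 1 = 1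
  w1 : ∀ α, f₀ (Ψ.bd α) = Ψ.bd (f₁ α)
  w2 : ∀ x y, f₀ x * f₀ y * Ψ.bd (κ x y) = f₀ (x * y)
  w3 : ∀ α β, f₁ α * f₁ β * κ (Ψ.bd α) (Ψ.bd β) = f₁ (α * β)
  w4 : ∀ x y z, Ψ.act (κ x y) (f₀ z) * κ (x * y) z = κ y z * κ x (y * z)
  w5 : ∀ α x, Ψ.act (f₁ α) (f₀ x) * κ (Ψ.bd α) x = f₁ (Ψ.act α x) * κ x (Ψ.bd (Ψ.act α x))

namespace WeakEnd

variable {Ψ : LieCrossedModule n I₀ G₀ I₁ G₁}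

section

variable (f : WeakEnd Ψ)

theorem κ_one_one : f.κ 1 1 = 1 := by
  have h := f.w3 1 1
  simpa [f.f₁_one] using h

theorem κ_one_left (z : G₀) : f.κ 1 z = 1 := by
  have h := f.w4 1 1 z
  rw [f.κ_one_one, Ψ.one_act, one_mul, one_mul, one_mul] at h
  exact left_eq_mul.mp h

theorem κ_one_right (x : G₀) : f.κ x 1 = 1 := by
  have h := f.w4 x 1 1
  rw [f.κ_one_one, f.f₀_one, Ψ.act_one, mul_one, mul_one, one_mul] at h
  exact mul_eq_left.mp h

/-- The effect of the monoidal functor belonging to `f` on arrows: it sends `(x, α)` to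
`(f₀ x, arr x α)`. -/
def arr (x : G₀) (α : G₁) : G₁ := f.f₁ α * f.κ x (Ψ.bd α)

theorem arr_one_left (α : G₁) : f.arr 1 α = f.f₁ α := by
  rw [arr, κ_one_left, mul_one]

theorem arr_one_right (x : G₀) : f.arr x 1 = 1 := by
  rw [arr, map_one, κ_one_right, f.f₁_one, mul_one]

theorem arr_bd (x : G₀) (α : G₁) : f.f₀ x * Ψ.bd (f.arr x α) = f.f₀ (x * Ψ.bd α) := by
  rw [arr, map_mul, ← f.w1, ← f.w2, mul_assoc]

/-- Moving an element past the value of `f₁`. -/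
theorem f₁_mul_act (α β : G₁) : f.f₁ α * Ψ.act β (f.f₀ (Ψ.bd α)) = β * f.f₁ α := by
  rw [f.w1, Ψ.mul_act_bd]

theorem arr_mul (x : G₀) (α β : G₁) :
    f.arr x (α * β) = f.arr x α * f.arr (x * Ψ.bd α) β := by
  have h4 := f.w4 x (Ψ.bd α) (Ψ.bd β)
  have h := f.f₁_mul_act β (f.κ x (Ψ.bd α))
  calc f.arr x (α * β)
      = f.f₁ α * f.f₁ β * (f.κ (Ψ.bd α) (Ψ.bd β) * f.κ x (Ψ.bd α * Ψ.bd β)) := by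
        rw [arr, ← f.w3, map_mul, mul_assoc]
    _ = f.f₁ α * (f.f₁ β * Ψ.act (f.κ x (Ψ.bd α)) (f.f₀ (Ψ.bd β))) *
          f.κ (x * Ψ.bd α) (Ψ.bd β) := by rw [← h4]; simp only [mul_assoc]
    _ = _ := by rw [h, arr, arr]; simp only [mul_assoc]

theorem arr_inv (x : G₀) (α : G₁) : f.arr (x * Ψ.bd α) α⁻¹ = (f.arr x α)⁻¹ := by
  apply eq_inv_of_mul_eq_one_right
  rw [← f.arr_mul, mul_inv_cancel, f.arr_one_right]

theorem natR (x y : G₀) (β : G₁) :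
    f.κ x y * f.arr (x * y) β = f.arr y β * f.κ x (y * Ψ.bd β) := by
  have h4 := f.w4 x y (Ψ.bd β)
  have h := f.f₁_mul_act β (f.κ x y)
  rw [arr, arr, ← mul_assoc, ← h, mul_assoc, h4, mul_assoc]

theorem natL (x y : G₀) (α : G₁) :
    f.κ x y * f.arr (x * y) (Ψ.act α y) =
      Ψ.act (f.arr x α) (f.f₀ y) * f.κ (x * Ψ.bd α) y := by
  have h4 := f.w4 x (Ψ.bd α) y
  have h4' := f.w4 x y (Ψ.bd (Ψ.act α y))
  have h := f.f₁_mul_act (Ψ.act α y) (f.κ x y)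
  calc f.κ x y * f.arr (x * y) (Ψ.act α y)
      = f.f₁ (Ψ.act α y) * (f.κ y (Ψ.bd (Ψ.act α y)) * f.κ x (y * Ψ.bd (Ψ.act α y))) := by
        rw [arr, ← mul_assoc, ← h, mul_assoc, h4']
    _ = Ψ.act (f.f₁ α) (f.f₀ y) * (f.κ (Ψ.bd α) y * f.κ x (Ψ.bd α * y)) := by
        rw [Ψ.mul_bd_act, ← mul_assoc, ← f.w5, mul_assoc]
    _ = _ := by rw [← h4, ← mul_assoc, ← Ψ.mul_act, arr]

end

/-- A weak endomorphism from the data of a monoidal functor. -/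
def ofFunctor (f₀ : G₀ → G₀) (f₁ : G₁ → G₁) (κ : G₀ → G₀ → G₁) (F : G₀ → G₁ → G₁)
    (contMDiff_f₀ : ContMDiff I₀ I₀ n f₀) (contMDiff_f₁ : ContMDiff I₁ I₁ n f₁)
    (contMDiff_κ : ContMDiff (I₀.prod I₀) I₁ n fun p : G₀ × G₀ => κ p.1 p.2)
    (hf : ∀ α, F 1 α = f₁ α) (f₀_one : f₀ 1 = 1)
    (κ_one_left : ∀ x, κ 1 x = 1) (κ_one_right : ∀ x, κ x 1 = 1)
    (F_one : ∀ x, F x 1 = 1)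
    (F_bd : ∀ x α, f₀ x * Ψ.bd (F x α) = f₀ (x * Ψ.bd α))
    (F_mul : ∀ x α β, F x (α * β) = F x α * F (x * Ψ.bd α) β)
    (κ_bd : ∀ x y, f₀ x * f₀ y * Ψ.bd (κ x y) = f₀ (x * y))
    (natR : ∀ x y β, κ x y * F (x * y) β = F y β * κ x (y * Ψ.bd β))
    (natL : ∀ x y α, κ x y * F (x * y) (Ψ.act α y) =
      Ψ.act (F x α) (f₀ y) * κ (x * Ψ.bd α) y)
    (w4 : ∀ x y z, Ψ.act (κ x y) (f₀ z) * κ (x * y) z = κ y z * κ x (y * z)) :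
    WeakEnd Ψ where
  f₀ := f₀
  f₁ := f₁
  κ := κ
  contMDiff_f₀ := contMDiff_f₀
  contMDiff_f₁ := contMDiff_f₁
  contMDiff_κ := contMDiff_κ
  f₀_one := f₀_one
  f₁_one := by rw [← hf, F_one]
  w1 α := by rw [← hf, ← one_mul (Ψ.bd α), ← F_bd, f₀_one, one_mul]
  w2 := κ_bd
  w3 α β := by
    have h := natR (Ψ.bd α) 1 β
    rw [κ_one_right, mul_one, one_mul, one_mul, hf] at h
    rw [← hf (α * β), F_mul, one_mul, h, hf, mul_assoc]
  w4 := w4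
  w5 α x := by
    have hR := natR x 1 (Ψ.act α x)
    have hL := natL 1 x α
    rw [κ_one_right, mul_one, one_mul, one_mul, hf] at hR
    rw [κ_one_left, one_mul, one_mul, one_mul, hf] at hL
    rw [← hL, hR]

/-- The identity. -/
def refl (Ψ : LieCrossedModule n I₀ G₀ I₁ G₁) : WeakEnd Ψ :=
  ofFunctor id id (fun _ _ => 1) (fun _ α => α) contMDiff_id contMDiff_id
    contMDiff_const (fun _ => rfl) rfl (fun _ => rfl) (fun _ => rfl) (fun _ => rfl)
    (fun _ _ => rfl) (fun _ _ _ => rfl) (fun _ _ => by simp) (fun _ _ _ => by simp)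
    (fun _ _ _ => by simp) (fun _ _ _ => by simp [Ψ.one_act])

theorem comp_κ_eq (f : WeakEnd Ψ) (a b : G₀) (γ : G₁) :
    f.f₁ γ * (Ψ.act (f.κ a b) (f.f₀ (Ψ.bd γ)) * f.κ (a * b) (Ψ.bd γ)) =
      f.κ a b * f.arr (a * b) γ := by
  rw [← mul_assoc, f.f₁_mul_act, arr, mul_assoc]

/-- Horizontal composition `(f, κ) (g, γ) = (f ∘ g, β)`, with
`β x y = f₁ (γ x y) * κ (g₀ x) (g₀ y) (bd (γ x y))`, where `κ x y z` stands for either side of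
the cocycle axiom `w4`. -/
def comp (f g : WeakEnd Ψ) : WeakEnd Ψ :=
  ofFunctor (f.f₀ ∘ g.f₀) (f.f₁ ∘ g.f₁)
    (fun x y => f.f₁ (g.κ x y) * (Ψ.act (f.κ (g.f₀ x) (g.f₀ y)) (f.f₀ (Ψ.bd (g.κ x y))) *
      f.κ (g.f₀ x * g.f₀ y) (Ψ.bd (g.κ x y))))
    (fun x α => f.arr (g.f₀ x) (g.arr x α))
    (f.contMDiff_f₀.comp g.contMDiff_f₀) (f.contMDiff_f₁.comp g.contMDiff_f₁)
    (by
      have h1 := g.contMDiff_f₀.comp (contMDiff_fst (I := I₀) (J := I₀) (M := G₀) (N := G₀))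
      have h2 := g.contMDiff_f₀.comp (contMDiff_snd (I := I₀) (J := I₀) (M := G₀) (N := G₀))
      have hb := Ψ.contMDiff_bd.comp g.contMDiff_κ
      have hk := f.contMDiff_κ.comp (h1.prodMk h2)
      exact (f.contMDiff_f₁.comp g.contMDiff_κ).mul
        ((Ψ.contMDiff_act.comp (hk.prodMk (f.contMDiff_f₀.comp hb))).mul
          (f.contMDiff_κ.comp ((h1.mul h2).prodMk hb))))
    (fun α => by simp [g.f₀_one, arr_one_left])
    (by simp [f.f₀_one, g.f₀_one])
    (fun x => by simp [g.κ_one_left, f.f₁_one, f.f₀_one, g.f₀_one, f.κ_one_left, f.κ_one_right,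
      Ψ.one_act])
    (fun x => by simp [g.κ_one_right, f.f₁_one, f.f₀_one, g.f₀_one, f.κ_one_left, f.κ_one_right,
      Ψ.one_act])
    (fun x => by rw [g.arr_one_right, f.arr_one_right])
    (fun x α => by simp [f.arr_bd, g.arr_bd])
    (fun x α β => by rw [g.arr_mul, f.arr_mul, g.arr_bd])
    (fun x y => by
      rw [f.comp_κ_eq, map_mul, ← mul_assoc, Function.comp_apply, Function.comp_apply, f.w2,
        f.arr_bd, g.w2]; rfl)
    (fun x y β => by
      rw [f.comp_κ_eq, f.comp_κ_eq, ← g.w2, mul_assoc, ← f.arr_mul, g.natR, f.arr_mul,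
        ← mul_assoc, f.natR, mul_assoc, mul_assoc, g.arr_bd])
    (fun x y α => by
      rw [f.comp_κ_eq, f.comp_κ_eq, ← g.w2, mul_assoc, ← f.arr_mul, g.natL, f.arr_mul,
        ← mul_assoc, f.natL, g.arr_bd, mul_assoc, mul_assoc, Ψ.mul_bd_act, ← mul_assoc (g.f₀ x),
        g.arr_bd]
      rfl)
    (fun x y z => by
      have hL := f.natL (g.f₀ x * g.f₀ y) (g.f₀ z) (g.κ x y)
      have hR := f.natR (g.f₀ x) (g.f₀ y * g.f₀ z) (g.κ y z)
      have hM := f.arr_mul (g.f₀ x * g.f₀ y * g.f₀ z) (Ψ.act (g.κ x y) (g.f₀ z)) (g.κ (x * y) z)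
      have hM' := f.arr_mul (g.f₀ x * (g.f₀ y * g.f₀ z)) (g.κ y z) (g.κ x (y * z))
      rw [mul_assoc (g.f₀ x * g.f₀ y), Ψ.mul_bd_act, ← mul_assoc (g.f₀ x * g.f₀ y), g.w2] at hM
      rw [mul_assoc (g.f₀ x), g.w2] at hM'
      rw [g.w2] at hL hR
      simp only [f.comp_κ_eq, Function.comp_apply]
      rw [Ψ.mul_act, mul_assoc, ← mul_assoc (Ψ.act (f.arr _ _) _), ← hL, mul_assoc (f.κ _ _),
        ← hM, g.w4, ← mul_assoc, f.w4, mul_assoc (g.f₀ x), hM', mul_assoc, mul_assoc,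
        ← mul_assoc (f.κ (g.f₀ x) _), hR, mul_assoc])

theorem comp_κ (f g : WeakEnd Ψ) (x y : G₀) :
    (f.comp g).κ x y = f.κ (g.f₀ x) (g.f₀ y) * f.arr (g.f₀ x * g.f₀ y) (g.κ x y) :=
  f.comp_κ_eq _ _ _

theorem comp_arr (f g : WeakEnd Ψ) (x : G₀) (α : G₁) :
    (f.comp g).arr x α = f.arr (g.f₀ x) (g.arr x α) := by
  have h := f.natR (g.f₀ x) 1 (g.f₁ α)
  rw [mul_one, one_mul, f.κ_one_right, one_mul, f.arr_one_left, ← g.w1] at h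
  have h' : (f.comp g).arr x α = f.f₁ (g.f₁ α) * (f.comp g).κ x (Ψ.bd α) := rfl
  rw [h', comp_κ, show g.arr x α = g.f₁ α * g.κ x (Ψ.bd α) from rfl, f.arr_mul, ← mul_assoc, h, g.w1]

/-- The monoid of weak endomorphisms. -/
instance : Monoid (WeakEnd Ψ) where
  one := refl Ψ
  mul := comp
  one_mul f := by
    ext x y
    · rfl
    · rfl
    · change (comp (refl Ψ) f).κ x y = _
      rw [comp_κ, arr]
      simp [refl, ofFunctor]
  mul_one f := by
    ext x y
    · rfl
    · rfl
    · change (comp f (refl Ψ)).κ x y = _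
      rw [comp_κ]
      simp [refl, ofFunctor, arr_one_right]
  mul_assoc f g h := by
    ext x y
    · rfl
    · rfl
    · change (comp (comp f g) h).κ x y = (comp f (comp g h)).κ x y
      have h2 : ∀ a, (comp g h).f₀ a = g.f₀ (h.f₀ a) := fun _ => rfl
      have h3 : ∀ a, (comp f g).f₀ a = f.f₀ (g.f₀ a) := fun _ => rfl
      simp only [comp_κ, comp_arr, f.arr_mul, h2, g.w2, mul_assoc]

theorem one_f₀ (x : G₀) : (1 : WeakEnd Ψ).f₀ x = x := rfl
theorem one_f₁ (α : G₁) : (1 : WeakEnd Ψ).f₁ α = α := rfl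
theorem mul_f₀ (f g : WeakEnd Ψ) (x : G₀) : (f * g).f₀ x = f.f₀ (g.f₀ x) := rfl
theorem mul_f₁ (f g : WeakEnd Ψ) (α : G₁) : (f * g).f₁ α = f.f₁ (g.f₁ α) := rfl
theorem mul_κ (f g : WeakEnd Ψ) (x y : G₀) :
    (f * g).κ x y = f.κ (g.f₀ x) (g.f₀ y) * f.arr (g.f₀ x * g.f₀ y) (g.κ x y) :=
  f.comp_κ_eq _ _ _
theorem mul_arr (f g : WeakEnd Ψ) (x : G₀) (α : G₁) :
    (f * g).arr x α = f.arr (g.f₀ x) (g.arr x α) := comp_arr f g x α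
theorem one_arr (x : G₀) (α : G₁) : (1 : WeakEnd Ψ).arr x α = α := mul_one _

end WeakEnd

/-- The pointed `C^n` maps from `G₀` to `G₁`. -/
@[ext]
structure PointedMap (Ψ : LieCrossedModule n I₀ G₀ I₁ G₁) where
  toFun : G₀ → G₁
  contMDiff : ContMDiff I₀ I₁ n toFun
  map_one : toFun 1 = 1

namespace PointedMap

variable {Ψ : LieCrossedModule n I₀ G₀ I₁ G₁}

instance : CoeFun (PointedMap Ψ) fun _ => G₀ → G₁ := ⟨toFun⟩

/-- The semi-group structure `(η₁ ∘ η₂) x = η₂ x * η₁ (x * bd (η₂ x))`. -/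
instance : Monoid (PointedMap Ψ) where
  one := ⟨fun _ => 1, contMDiff_const, rfl⟩
  mul η₁ η₂ := ⟨fun x => η₂ x * η₁ (x * Ψ.bd (η₂ x)),
    η₂.contMDiff.mul (η₁.contMDiff.comp (contMDiff_id.mul (Ψ.contMDiff_bd.comp η₂.contMDiff))),
    by simp [η₁.map_one, η₂.map_one]⟩
  one_mul η := PointedMap.ext (funext fun x => mul_one (η x))
  mul_one η := PointedMap.ext (funext fun x => by
    change 1 * η (x * Ψ.bd 1) = η x
    simp)
  mul_assoc η₁ η₂ η₃ := PointedMap.ext (funext fun x => by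
    change η₃ x * (η₂ _ * η₁ _) = (η₃ x * η₂ _) * η₁ _
    rw [mul_assoc, mul_assoc, ← map_mul]
    rfl)

theorem one_apply (x : G₀) : (1 : PointedMap Ψ) x = 1 := rfl
theorem mul_apply (η₁ η₂ : PointedMap Ψ) (x : G₀) :
    (η₁ * η₂) x = η₂ x * η₁ (x * Ψ.bd (η₂ x)) := rfl

/-- The weak endomorphism `δ η`. -/
def toWeakEnd (η : PointedMap Ψ) : WeakEnd Ψ :=
  WeakEnd.ofFunctor (fun x => x * Ψ.bd (η x)) (fun α => α * η (Ψ.bd α))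
    (fun x y => (η y)⁻¹ * (Ψ.act (η x) y)⁻¹ * η (x * y))
    (fun x α => (η x)⁻¹ * α * η (x * Ψ.bd α))
    (contMDiff_id.mul (Ψ.contMDiff_bd.comp η.contMDiff))
    (contMDiff_id.mul (η.contMDiff.comp Ψ.contMDiff_bd))
    (by
      have h1 := contMDiff_fst (n := n) (I := I₀) (J := I₀) (M := G₀) (N := G₀)
      have h2 := contMDiff_snd (n := n) (I := I₀) (J := I₀) (M := G₀) (N := G₀)
      exact ((η.contMDiff.comp h2).inv.mul
        (Ψ.contMDiff_act.comp ((η.contMDiff.comp h1).prodMk h2)).inv).mul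
          (η.contMDiff.comp (h1.mul h2)))
    (fun α => by simp [η.map_one])
    (by simp [η.map_one])
    (fun x => by simp [η.map_one, Ψ.one_act])
    (fun x => by simp [η.map_one, Ψ.act_one])
    (fun x => by simp)
    (fun x α => by simp [mul_assoc])
    (fun x α β => by simp [mul_assoc])
    (fun x y => by
      simp only [map_mul, map_inv, Ψ.bd_act]; group)
    (fun x y β => by
      simp only [Ψ.act_mul, Ψ.peiffer, mul_inv_rev, inv_inv, mul_assoc, mul_inv_cancel_left,
        inv_mul_cancel_left])
    (fun x y α => by
      simp only [Ψ.act_mul, Ψ.peiffer, Ψ.mul_act, Ψ.inv_act, Ψ.mul_bd_act, mul_inv_rev, inv_inv,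
        mul_assoc, mul_inv_cancel_left, inv_mul_cancel_left])
    (fun x y z => by
      simp only [Ψ.act_mul, Ψ.peiffer, Ψ.mul_act, Ψ.inv_act, mul_inv_rev, inv_inv,
        mul_assoc, mul_inv_cancel_left, inv_mul_cancel_left])

theorem toWeakEnd_f₀ (η : PointedMap Ψ) (x : G₀) : η.toWeakEnd.f₀ x = x * Ψ.bd (η x) := rfl
theorem toWeakEnd_f₁ (η : PointedMap Ψ) (α : G₁) : η.toWeakEnd.f₁ α = α * η (Ψ.bd α) := rfl
theorem toWeakEnd_κ (η : PointedMap Ψ) (x y : G₀) :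
    η.toWeakEnd.κ x y = (η y)⁻¹ * (Ψ.act (η x) y)⁻¹ * η (x * y) := rfl
theorem toWeakEnd_arr (η : PointedMap Ψ) (x : G₀) (α : G₁) :
    η.toWeakEnd.arr x α = (η x)⁻¹ * α * η (x * Ψ.bd α) := by
  simp only [WeakEnd.arr, toWeakEnd_f₁, toWeakEnd_κ, Ψ.peiffer, mul_inv_rev, inv_inv,
    mul_assoc, mul_inv_cancel_left]

/-- The structure map `δ` of the weak actor. -/
def delta : PointedMap Ψ →* WeakEnd Ψ where
  toFun := toWeakEnd
  map_one' := by
    ext x y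
    · change x * Ψ.bd 1 = x
      simp
    · exact mul_one _
    · change (1 : G₁)⁻¹ * (Ψ.act 1 y)⁻¹ * 1 = 1
      simp [Ψ.one_act]
  map_mul' η₁ η₂ := by
    ext x y
    · change x * Ψ.bd (η₂ x * η₁ _) = x * Ψ.bd (η₂ x) * Ψ.bd (η₁ _)
      rw [map_mul, mul_assoc]
      rfl
    · change _ * (η₂ _ * η₁ _) = (_ * η₂ _) * η₁ (Ψ.bd (_ * η₂ _))
      rw [map_mul, mul_assoc]
    · have h : x * Ψ.bd (η₂ x) * (y * Ψ.bd (η₂ y)) * Ψ.bd (η₂.toWeakEnd.κ x y) =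
          x * y * Ψ.bd (η₂ (x * y)) := η₂.toWeakEnd.w2 x y
      rw [WeakEnd.mul_κ, toWeakEnd_arr, toWeakEnd_κ, toWeakEnd_κ, mul_apply, mul_apply, mul_apply,
        toWeakEnd_f₀, toWeakEnd_f₀, h, toWeakEnd_κ]
      simp only [Ψ.act_mul, Ψ.peiffer, Ψ.mul_act, mul_inv_rev, inv_inv,
        mul_assoc, mul_inv_cancel_left, inv_mul_cancel_left]

/-- The action `η ^ u` of an invertible weak endomorphism `u = (f, κ)`, with inverse
`(f⁻¹, γ)`: `η ^ u` sends `x` to `f₁⁻¹ (η (f₀ x)) * γ (f₀ x) (bd (η (f₀ x)))`. -/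
def conj (η : PointedMap Ψ) (u : (WeakEnd Ψ)ˣ) : PointedMap Ψ where
  toFun x := (u⁻¹).1.f₁ (η (u.1.f₀ x)) * (u⁻¹).1.κ (u.1.f₀ x) (Ψ.bd (η (u.1.f₀ x)))
  contMDiff := by
    have h := η.contMDiff.comp u.1.contMDiff_f₀
    exact ((u⁻¹).1.contMDiff_f₁.comp h).mul
      ((u⁻¹).1.contMDiff_κ.comp (u.1.contMDiff_f₀.prodMk (Ψ.contMDiff_bd.comp h)))
  map_one := by
    simp [u.1.f₀_one, η.map_one, (u⁻¹).1.f₁_one, WeakEnd.κ_one_one]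

theorem conj_apply (η : PointedMap Ψ) (u : (WeakEnd Ψ)ˣ) (x : G₀) :
    η.conj u x = (u⁻¹).1.arr (u.1.f₀ x) (η (u.1.f₀ x)) := rfl

theorem _root_.WeakEnd.inv_f₀_f₀ (u : (WeakEnd Ψ)ˣ) (x : G₀) : (u⁻¹).1.f₀ (u.1.f₀ x) = x := by
  rw [← WeakEnd.mul_f₀, ← Units.val_mul, inv_mul_cancel]; rfl

theorem _root_.WeakEnd.f₀_inv_f₀ (u : (WeakEnd Ψ)ˣ) (x : G₀) : u.1.f₀ ((u⁻¹).1.f₀ x) = x := by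
  rw [← WeakEnd.mul_f₀, ← Units.val_mul, mul_inv_cancel]; rfl

theorem _root_.WeakEnd.arr_inv_arr (u : (WeakEnd Ψ)ˣ) (x : G₀) (α : G₁) :
    u.1.arr ((u⁻¹).1.f₀ x) ((u⁻¹).1.arr x α) = α := by
  rw [← WeakEnd.mul_arr, ← Units.val_mul, mul_inv_cancel]; exact WeakEnd.one_arr _ _

theorem mul_bd_conj (η : PointedMap Ψ) (u : (WeakEnd Ψ)ˣ) (x : G₀) :
    x * Ψ.bd (η.conj u x) = (u⁻¹).1.f₀ (u.1.f₀ x * Ψ.bd (η (u.1.f₀ x))) := by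
  rw [conj_apply, ← WeakEnd.arr_bd, WeakEnd.inv_f₀_f₀]

theorem arr_conj (η : PointedMap Ψ) (u : (WeakEnd Ψ)ˣ) (x : G₀) :
    u.1.arr x (η.conj u x) = η (u.1.f₀ x) := by
  have h := WeakEnd.arr_inv_arr u (u.1.f₀ x) (η (u.1.f₀ x))
  rwa [WeakEnd.inv_f₀_f₀] at h

theorem conj_one (η : PointedMap Ψ) : η.conj 1 = η := by
  ext x
  rw [conj_apply, inv_one, Units.val_one, WeakEnd.one_arr, WeakEnd.one_f₀]

theorem conj_mul (η : PointedMap Ψ) (u v : (WeakEnd Ψ)ˣ) :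
    η.conj (u * v) = (η.conj u).conj v := by
  ext x
  rw [conj_apply, conj_apply, conj_apply, mul_inv_rev, Units.val_mul, Units.val_mul,
    WeakEnd.mul_arr, WeakEnd.mul_f₀, WeakEnd.inv_f₀_f₀]

theorem one_conj (u : (WeakEnd Ψ)ˣ) : (1 : PointedMap Ψ).conj u = 1 := by
  ext x
  rw [conj_apply, one_apply, WeakEnd.arr_one_right, one_apply]

theorem mul_conj (η₁ η₂ : PointedMap Ψ) (u : (WeakEnd Ψ)ˣ) :
    (η₁ * η₂).conj u = η₁.conj u * η₂.conj u := by
  ext x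
  rw [conj_apply, mul_apply, mul_apply, WeakEnd.arr_mul, mul_bd_conj, conj_apply, conj_apply,
    WeakEnd.f₀_inv_f₀]

/-- The action of a fixed `u` as a homomorphism. -/
def conjHom (u : (WeakEnd Ψ)ˣ) : PointedMap Ψ →* PointedMap Ψ where
  toFun η := η.conj u
  map_one' := one_conj u
  map_mul' η₁ η₂ := mul_conj η₁ η₂ u

theorem mul_delta_conj (η : PointedMap Ψ) (u : (WeakEnd Ψ)ˣ) :
    u.1 * delta (η.conj u) = delta η * u.1 := by
  have hd : ∀ ζ : PointedMap Ψ, delta ζ = ζ.toWeakEnd := fun _ => rfl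
  rw [hd, hd]
  ext x y
  · rw [WeakEnd.mul_f₀, WeakEnd.mul_f₀, toWeakEnd_f₀, mul_bd_conj, WeakEnd.f₀_inv_f₀]
    rfl
  · rw [WeakEnd.mul_f₁, WeakEnd.mul_f₁, toWeakEnd_f₁, toWeakEnd_f₁, ← u.1.arr_one_left,
      u.1.arr_mul, u.1.arr_one_left, one_mul, arr_conj, u.1.w1]
  · have hR := u.1.natR (x * Ψ.bd (η.conj u x)) y (η.conj u y)
    have hL := u.1.natL x y (η.conj u x)
    have hw : x * Ψ.bd (η.conj u x) * (y * Ψ.bd (η.conj u y)) *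
        Ψ.bd ((η.conj u).toWeakEnd.κ x y) = x * y * Ψ.bd (η.conj u (x * y)) :=
      (η.conj u).toWeakEnd.w2 x y
    have hK : Ψ.act (η.conj u x) y * (η.conj u y * (η.conj u).toWeakEnd.κ x y) =
        η.conj u (x * y) := by
      rw [toWeakEnd_κ]; group
    have hm := u.1.arr_mul (x * y) (Ψ.act (η.conj u x) y)
      (η.conj u y * (η.conj u).toWeakEnd.κ x y)
    rw [hK, arr_conj, mul_assoc x y, Ψ.mul_bd_act, ← mul_assoc x, u.1.arr_mul,
      mul_assoc (x * _) y] at hm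
    have hη : Ψ.act (η (u.1.f₀ x)) (u.1.f₀ y) * (η (u.1.f₀ y) *
        (u.1 * (η.conj u).toWeakEnd).κ x y) = u.1.κ x y * η (u.1.f₀ (x * y)) := by
      rw [hm, ← mul_assoc (u.1.κ x y), hL, mul_assoc, ← mul_assoc (u.1.κ _ y), hR, arr_conj,
        arr_conj, WeakEnd.mul_κ, mul_assoc]
      rfl
    rw [← eq_inv_mul_iff_mul_eq, ← eq_inv_mul_iff_mul_eq] at hη
    rw [hη, WeakEnd.mul_κ, toWeakEnd_arr, toWeakEnd_κ, u.1.w2]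
    group

theorem delta_mul_conj (η β : PointedMap Ψ) (u : (WeakEnd Ψ)ˣ)
    (hu : u.1 = delta η) : η * β.conj u = β * η := by
  ext x
  have h := arr_conj β u x
  rw [hu] at h
  have h' : (delta η).arr x (β.conj u x) = _ := toWeakEnd_arr η x _
  rw [h', mul_assoc, inv_mul_eq_iff_eq_mul] at h
  exact h

end PointedMap

/-- The weak actor crossed module of `Ψ`. Its groups are those of the invertible weak
endomorphisms and of the invertible pointed maps. -/
def wAct (Ψ : LieCrossedModule n I₀ G₀ I₁ G₁) :
    CrossedModule (WeakEnd Ψ)ˣ (PointedMap Ψ)ˣ where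
  bd := Units.map PointedMap.delta
  act η u := Units.map (PointedMap.conjHom u) η
  act_one η := Units.ext (PointedMap.conj_one _)
  act_mul η u v := Units.ext (PointedMap.conj_mul _ u v)
  mul_act η₁ η₂ u := map_mul _ _ _
  bd_act η u := by
    rw [mul_assoc, eq_inv_mul_iff_mul_eq]
    exact Units.ext (PointedMap.mul_delta_conj _ u)
  peiffer η β := by
    rw [mul_assoc, eq_inv_mul_iff_mul_eq]
    exact Units.ext (PointedMap.delta_mul_conj _ _ _ rfl)

/-- The subgroup of centre-preserving weak automorphisms: those that restrict to the identity on
`π₁(Ψ) = ker bd`. -/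
def centrePreserving (Ψ : LieCrossedModule n I₀ G₀ I₁ G₁) : Subgroup (WeakEnd Ψ)ˣ where
  carrier := {u | ∀ α, Ψ.bd α = 1 → u.1.f₁ α = α}
  one_mem' _ _ := rfl
  mul_mem' {u v} hu hv α hα := by
    rw [Units.val_mul, WeakEnd.mul_f₁, hv α hα, hu α hα]
  inv_mem' {u} hu α hα := by
    have h : (u⁻¹).1.f₁ (u.1.f₁ α) = α := by
      rw [← WeakEnd.mul_f₁, ← Units.val_mul, inv_mul_cancel]; rfl
    rwa [hu α hα] at h

/-- The crossed module `wAct⁺(Ψ)` of centre-preserving weak automorphisms. -/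
def wActPlus (Ψ : LieCrossedModule n I₀ G₀ I₁ G₁) :
    CrossedModule (centrePreserving Ψ) (PointedMap Ψ)ˣ :=
  (wAct Ψ).restrict (centrePreserving Ψ) fun η α hα => by
    change α * η.1 (Ψ.bd α) = α
    rw [hα, η.1.map_one, mul_one]

end LieCrossedModule

/-! ### The crossed module `Ξ` -/

section Xi

variable {L : Type u} [AddCommGroup L] [Module ℤ L]

/-- The pull-back `f^* B` of a bilinear form. -/
def pullForm (B : LinearMap.BilinForm ℤ L) (f : L ≃ₗ[ℤ] L) : LinearMap.BilinForm ℤ L :=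
  LinearMap.compl₁₂ B f.toLinearMap f.toLinearMap

@[simp] theorem pullForm_apply (B : LinearMap.BilinForm ℤ L) (f : L ≃ₗ[ℤ] L) (m n : L) :
    pullForm B f m n = B (f m) (f n) := rfl

/-- The isometry group `O(L, I)`. -/
def isometryGroup (I : LinearMap.BilinForm ℤ L) : Subgroup (L ≃ₗ[ℤ] L) where
  carrier := {f | ∀ m n, I (f m) (f n) = I m n}
  one_mem' _ _ := rfl
  mul_mem' {f g} hf hg m n := by
    rw [LinearEquiv.mul_apply, LinearEquiv.mul_apply, hf, hg]
  inv_mem' {f} hf m n := by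
    rw [← hf, ← LinearEquiv.mul_apply, ← LinearEquiv.mul_apply, mul_inv_cancel]; rfl

/-- The group of all pairs `(f, B)` of an isometry `f` of `I = J + Jᵗ` and a bilinear form `B`
with `B - Bᵗ = J - f^* J`. -/
@[ext]
structure OTilde (J : LinearMap.BilinForm ℤ L) where
  f : isometryGroup (J + J.flip)
  B : LinearMap.BilinForm ℤ L
  cond : B - B.flip = J - pullForm J f.1

namespace OTilde

variable {J : LinearMap.BilinForm ℤ L}

theorem cond_apply (a : OTilde J) (m n : L) :
    a.B m n - a.B n m = J m n - J (a.f.1 m) (a.f.1 n) :=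
  LinearMap.congr_fun₂ a.cond m n

/-- The multiplication of the semi-direct product, `(f, B) (g, C) = (f ∘ g, g^* B + C)`. -/
instance : Group (OTilde J) where
  mul a b := ⟨a.f * b.f, pullForm a.B b.f.1 + b.B, by
    ext m n
    have h1 := a.cond_apply (b.f.1 m) (b.f.1 n)
    have h2 := b.cond_apply m n
    simp only [LinearMap.sub_apply, LinearMap.add_apply, LinearMap.BilinForm.flip_apply,
      pullForm_apply, Subgroup.coe_mul, LinearEquiv.mul_apply]
    linarith⟩
  one := ⟨1, 0, by ext m n; simp⟩
  inv a := ⟨a.f⁻¹, -pullForm a.B a.f⁻¹.1, by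
    ext m n
    have h1 := a.cond_apply (a.f⁻¹.1 m) (a.f⁻¹.1 n)
    have h2 : ∀ k, a.f.1 (a.f⁻¹.1 k) = k := fun k => by
      rw [← LinearEquiv.mul_apply, ← Subgroup.coe_mul, mul_inv_cancel]; rfl
    rw [h2, h2] at h1
    simp only [LinearMap.sub_apply, LinearMap.neg_apply, LinearMap.BilinForm.flip_apply, pullForm_apply]
    linarith⟩
  mul_assoc a b c := by
    apply OTilde.ext
    · exact mul_assoc _ _ _
    · exact LinearMap.ext₂ fun m n => add_assoc _ _ _
  one_mul a := by
    apply OTilde.ext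
    · exact one_mul _
    · exact LinearMap.ext₂ fun m n => zero_add _
  mul_one a := by
    apply OTilde.ext
    · exact mul_one _
    · exact LinearMap.ext₂ fun m n => add_zero _
  inv_mul_cancel a := by
    apply OTilde.ext
    · exact inv_mul_cancel _
    · refine LinearMap.ext₂ fun m n => ?_
      change -a.B (a.f⁻¹.1 (a.f.1 m)) (a.f⁻¹.1 (a.f.1 n)) + a.B m n = 0
      have h2 : ∀ k, a.f⁻¹.1 (a.f.1 k) = k := fun k => by
        rw [← LinearEquiv.mul_apply, ← Subgroup.coe_mul, inv_mul_cancel]; rfl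
      rw [h2, h2, neg_add_cancel]

theorem mul_f (a b : OTilde J) : (a * b).f = a.f * b.f := rfl
theorem mul_B (a b : OTilde J) : (a * b).B = pullForm a.B b.f.1 + b.B := rfl
theorem one_f : (1 : OTilde J).f = 1 := rfl
theorem one_B : (1 : OTilde J).B = 0 := rfl

theorem mul_B_apply (a b : OTilde J) (m n : L) :
    (a * b).B m n = a.B (b.f.1 m) (b.f.1 n) + b.B m n := rfl

/-- The projection to the isometry group. -/
def toIsometry : OTilde J →* isometryGroup (J + J.flip) where
  toFun := f
  map_one' := rfl
  map_mul' _ _ := rfl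

variable (J) in
/-- The subgroup of the pairs `(id, B)` with `B` symmetric and even. -/
def evenSubgroup : Subgroup (OTilde J) where
  carrier := {a | a.f = 1 ∧ (∀ m n, a.B m n = a.B n m) ∧ ∀ m, Even (a.B m m)}
  one_mem' := ⟨rfl, fun _ _ => rfl, fun _ => Even.zero⟩
  mul_mem' {a b} ha hb := by
    obtain ⟨ha1, ha2, ha3⟩ := ha
    obtain ⟨hb1, hb2, hb3⟩ := hb
    refine ⟨by rw [mul_f, ha1, hb1, one_mul], fun m n => ?_, fun m => ?_⟩
    · rw [mul_B_apply, mul_B_apply, ha2, hb2]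
    · rw [mul_B_apply]; exact (ha3 _).add (hb3 _)
  inv_mem' {a} ha := by
    obtain ⟨ha1, ha2, ha3⟩ := ha
    refine ⟨?_, fun m n => ?_, fun m => ?_⟩
    · change a.f⁻¹ = 1
      rw [ha1, inv_one]
    · change -a.B _ _ = -a.B _ _
      rw [ha2]
    · change Even (-a.B _ _)
      exact (ha3 _).neg

theorem mem_evenSubgroup {a : OTilde J} : a ∈ evenSubgroup J ↔
    a.f = 1 ∧ (∀ m n, a.B m n = a.B n m) ∧ ∀ m, Even (a.B m m) := Iff.rfl

instance : (evenSubgroup J).Normal where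
  conj_mem a ha b := by
    obtain ⟨ha1, ha2, ha3⟩ := ha
    have key : ∀ m n, (b * a * b⁻¹).B m n = a.B (b⁻¹.f.1 m) (b⁻¹.f.1 n) := fun m n => by
      have h : ∀ m n, (b * a).B m n = b.B m n + a.B m n := fun m n => by
        rw [mul_B_apply, ha1]; rfl
      have h0 : b.B (b⁻¹.f.1 m) (b⁻¹.f.1 n) + b⁻¹.B m n = 0 := by
        rw [← mul_B_apply, mul_inv_cancel]; rfl
      rw [mul_B_apply, h, add_right_comm, h0, zero_add]
    refine ⟨?_, fun m n => ?_, fun m => ?_⟩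
    · rw [mul_f, mul_f, ha1, mul_one, ← mul_f, mul_inv_cancel]; rfl
    · rw [key, key, ha2]
    · rw [key]; exact ha3 _

end OTilde

/-- The group `E`. -/
abbrev EGroup (J : LinearMap.BilinForm ℤ L) : Type u := OTilde J ⧸ OTilde.evenSubgroup J

/-- The projection of `E` to the isometry group. -/
def EGroup.toIsometry (J : LinearMap.BilinForm ℤ L) : EGroup J →* isometryGroup (J + J.flip) :=
  QuotientGroup.lift _ OTilde.toIsometry fun _ h => h.1

/-- The element `(id, λ ⊗ λ)`, where `λ ⊗ λ` is the bilinear form `(m, n) ↦ λ m * λ n`. -/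
def OTilde.square (J : LinearMap.BilinForm ℤ L) (l : Module.Dual ℤ L) : OTilde J where
  f := 1
  B := LinearMap.mk₂ ℤ (fun m n => l m * l n) (fun _ _ _ => by simp [add_mul])
    (fun _ _ _ => by simp [mul_assoc]) (fun _ _ _ => by simp [mul_add])
    (fun _ _ _ => by simp [mul_left_comm])
  cond := by
    ext m n
    simp [mul_comm]

/-- The crossed module `Ξ : Λ → E`, `λ ↦ (id, [λ ⊗ λ])`, where `Λ` is the dual of `L` and `(f, B)`
acts on `Λ` via `f^*`. -/
def Xi (J : LinearMap.BilinForm ℤ L) :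
    CrossedModule (EGroup J) (Multiplicative (Module.Dual ℤ L)) where
  bd := MonoidHom.mk' (fun l => QuotientGroup.mk (OTilde.square J l.toAdd)) fun l l' => by
    rw [← QuotientGroup.mk_mul, QuotientGroup.eq]
    have key : ∀ m n, ((OTilde.square J (l * l').toAdd)⁻¹ *
        (OTilde.square J l.toAdd * OTilde.square J l'.toAdd)).B m n =
        -(l.toAdd m * l'.toAdd n + l'.toAdd m * l.toAdd n) := fun m n => by
      change -((l.toAdd m + l'.toAdd m) * (l.toAdd n + l'.toAdd n)) +
        (l.toAdd m * l.toAdd n + l'.toAdd m * l'.toAdd n) = _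
      ring
    refine ⟨rfl, fun m n => ?_, fun m => ?_⟩
    · rw [key, key]; ring
    · rw [key]; exact ⟨-(l.toAdd m * l'.toAdd m), by ring⟩
  act l a := Multiplicative.ofAdd (l.toAdd ∘ₗ (EGroup.toIsometry J a).1.toLinearMap)
  act_one l := by
    rw [map_one]; rfl
  act_mul l a b := by
    rw [map_mul]; rfl
  mul_act l l' a := rfl
  bd_act l a := by
    induction a using QuotientGroup.induction_on with
    | H a =>
    rw [mul_assoc, eq_inv_mul_iff_mul_eq]
    change QuotientGroup.mk (a * _) = QuotientGroup.mk (_ * a)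
    congr 1
    apply OTilde.ext
    · exact (mul_one _).trans (one_mul _).symm
    · refine LinearMap.ext₂ fun m n => ?_
      exact add_comm _ _
  peiffer l l' := by
    rw [mul_comm _ l', inv_mul_cancel_right]
    rfl

end Xi

/-! ### Categorical tori -/

section Torus

variable {V : Type u} [NormedAddCommGroup V] [NormedSpace ℝ V]

instance : ChartedSpace V (Multiplicative V) := inferInstanceAs (ChartedSpace V V)

instance (n : WithTop ℕ∞) : LieGroup 𝓘(ℝ, V) n (Multiplicative V) where
  toIsManifold := inferInstanceAs (IsManifold 𝓘(ℝ, V) n V)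
  contMDiff_mul := contMDiff_add 𝓘(ℝ, V) n (G := V)
  contMDiff_inv := contMDiff_neg 𝓘(ℝ, V) n (G := V)

/-- A discrete group is a Lie group of dimension zero. -/
instance (L : Submodule ℤ V) [DiscreteTopology L] : ChartedSpace PUnit.{1} (Multiplicative L) :=
  ChartedSpace.ofDiscreteTopology

instance (L : Submodule ℤ V) [DiscreteTopology L] (n : WithTop ℕ∞) :
    LieGroup 𝓘(ℝ, PUnit.{1}) n (Multiplicative L) where
  toIsManifold := .of_discreteTopology _
  contMDiff_mul :=
    have : DiscreteTopology (Multiplicative L × Multiplicative L) :=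
      inferInstanceAs (DiscreteTopology (L × L))
    contMDiff_of_discreteTopology
  contMDiff_inv := contMDiff_of_discreteTopology

variable [FiniteDimensional ℝ V] (L : Submodule ℤ V) [DiscreteTopology L] [IsZLattice ℝ L]

/-- The `ℝ`-linear extension of `l : L → ℤ` to `V = L ⊗ ℝ`. -/
noncomputable def dualExt (l : Module.Dual ℤ L) : V →ₗ[ℝ] ℝ :=
  ((Module.Free.chooseBasis ℤ L).ofZLatticeBasis ℝ L).constr ℝ
    fun i => (l (Module.Free.chooseBasis ℤ L i) : ℝ)

theorem dualExt_coe (l : Module.Dual ℤ L) (m : L) : dualExt L l (m : V) = l m := by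
  have h : ((dualExt L l).toAddMonoidHom.comp L.subtype.toAddMonoidHom).toIntLinearMap =
      ((Int.castAddHom ℝ).comp l.toAddMonoidHom).toIntLinearMap :=
    (Module.Free.chooseBasis ℤ L).ext fun i => by
      change dualExt L l (Module.Free.chooseBasis ℤ L i : V) = (l _ : ℝ)
      rw [← Module.Basis.ofZLatticeBasis_apply ℝ L, dualExt, Module.Basis.constr_basis]
  exact LinearMap.congr_fun h m

/-- The `ℝ`-bilinear extension of `J` to `V = L ⊗ ℝ`. -/
noncomputable def formExt (J : LinearMap.BilinForm ℤ L) : V →ₗ[ℝ] V →ₗ[ℝ] ℝ :=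
  ((Module.Free.chooseBasis ℤ L).ofZLatticeBasis ℝ L).constr ℝ
    fun i => dualExt L (J (Module.Free.chooseBasis ℤ L i))

theorem formExt_coe (J : LinearMap.BilinForm ℤ L) (m n : L) :
    formExt L J (m : V) (n : V) = J m n := by
  have h : (((formExt L J).flip n).toAddMonoidHom.comp L.subtype.toAddMonoidHom).toIntLinearMap =
      ((Int.castAddHom ℝ).comp (J.flip n).toAddMonoidHom).toIntLinearMap :=
    (Module.Free.chooseBasis ℤ L).ext fun i => by
      change formExt L J (Module.Free.chooseBasis ℤ L i : V) (n : V) = (J _ n : ℝ)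
      rw [← Module.Basis.ofZLatticeBasis_apply ℝ L, formExt, Module.Basis.constr_basis,
        dualExt_coe]
  exact LinearMap.congr_fun h m

/-- The crossed module `Θ : L × U(1) → V`, `(m, z) ↦ m`, where `x` acts by
`(m, z) ^ x = (m, z * exp (2 π i J(m, x)))`. The additive groups `V` and `L` are written
multiplicatively. -/
noncomputable def Theta (n : WithTop ℕ∞) (J : LinearMap.BilinForm ℤ L) :
    LieCrossedModule n 𝓘(ℝ, V) (Multiplicative V)
      (𝓘(ℝ, PUnit.{1}).prod (𝓡 1)) (Multiplicative L × Circle) where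
  bd := (AddMonoidHom.toMultiplicative L.subtype.toAddMonoidHom).comp (MonoidHom.fst _ _)
  act α x := (α.1, α.2 * Circle.exp (2 * Real.pi * formExt L J (α.1.toAdd : V) x.toAdd))
  act_one α := by
    simp
  act_mul α x y := by
    simp [mul_add, mul_assoc, Circle.exp_add]
  mul_act α β x := by
    ext
    · rfl
    · simp [mul_add, Circle.exp_add]; ring
  bd_act α x := by
    rw [mul_comm _ x, mul_inv_cancel_left]
    rfl
  peiffer α β := by
    have h : Circle.exp (2 * Real.pi * formExt L J (β.1.toAdd : V) (α.1.toAdd : V)) = 1 := by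
      rw [formExt_coe, mul_comm, Circle.exp_int_mul_two_pi]
    rw [mul_comm _ β, inv_mul_cancel_right]
    refine Prod.ext rfl ?_
    change β.2 * Circle.exp (2 * Real.pi * formExt L J (β.1.toAdd : V) (α.1.toAdd : V)) = β.2
    rw [h, mul_one]
  contMDiff_bd := by
    have h : ContMDiff 𝓘(ℝ, PUnit.{1}) 𝓘(ℝ, V) n
        (AddMonoidHom.toMultiplicative L.subtype.toAddMonoidHom) :=
      have : DiscreteTopology (Multiplicative L) := inferInstanceAs (DiscreteTopology L)
      contMDiff_of_discreteTopology
    exact h.comp contMDiff_fst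
  contMDiff_act := by
    have h : ContMDiff 𝓘(ℝ, PUnit.{1}) 𝓘(ℝ, V) n (fun m : Multiplicative L => (m.toAdd : V)) :=
      have : DiscreteTopology (Multiplicative L) := inferInstanceAs (DiscreteTopology L)
      contMDiff_of_discreteTopology
    have h0 : ContMDiff 𝓘(ℝ, V) 𝓘(ℝ, V) n (fun x : Multiplicative V => x.toAdd) := contMDiff_id
    have h1 : ContDiff ℝ n fun p : V × V => 2 * Real.pi * formExt L J p.1 p.2 :=
      contDiff_const.mul (LinearMap.toContinuousLinearMap
        ((LinearMap.toContinuousLinearMap : (V →ₗ[ℝ] ℝ) ≃ₗ[ℝ] _).toLinearMap ∘ₗ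
          formExt L J)).isBoundedBilinearMap.contDiff
    have h2 := h1.contMDiff.comp
      (((h.comp contMDiff_fst).comp contMDiff_fst).prodMk_space (h0.comp contMDiff_snd) :
        ContMDiff ((𝓘(ℝ, PUnit.{1}).prod (𝓡 1)).prod 𝓘(ℝ, V)) 𝓘(ℝ, V × V) n
          fun p : (Multiplicative L × Circle) × Multiplicative V => ((p.1.1.toAdd : V), p.2.toAdd))
    exact (contMDiff_fst.comp contMDiff_fst).prodMk
      ((contMDiff_snd.comp contMDiff_fst).mul (contMDiff_circleExp.comp h2))

/-- The torus `T = V / L`. -/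
abbrev Torus : Type u := V ⧸ L.toAddSubgroup

/-- The character group `Hom(T, U(1))` of continuous characters of `T`. -/
abbrev CharTorus : Type u := Multiplicative (Torus L) →ₜ* Circle

end Torus

/-! The source of rigidity is that `V` is connected and simply connected while the lattice is
discrete. Pointed maps from `V` or `V × V` to `L × U(1)` have trivial lattice component, so every
`η` and every `κ` is circle-valued with trivial boundary. Hence `f₀` is additive and continuous,
that is, `ℝ`-linear, and it preserves `L`. Moreover `κ = exp (2πi K)` for a real 2-cocycle `K` of
the same regularity (`WeakEnd.exists_real_cocycle`).

The antisymmetrization of `K` is bilinear, and equivariance (w5) identifies it with `J - f^*J`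
(`WeakEnd.antisymmetrization_eq`). So `J - f^*J` is skew, which says that `f` is an isometry of `I =
J + Jᵗ`. If `f` is the identity on `L`, then `K` is symmetric, hence the coboundary of a function
`h` (`IsRealCocycle.exists_primitive`). After correcting `h` by a linear form, the weak automorphism
is the boundary of `exp (2πi h)` (`WeakEnd.exists_delta_eq`). Thus the homomorphism to isometries
has exactly the image of `delta` as kernel. It is surjective, because a skew integral form with zero
diagonal can be written `B - Bᵗ` (`OTilde.exists_of_isometry`).

For the equivalence, `(f, B) ↦ (f, exp (2πi B))` is a homomorphism from `OTilde J` to weak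
automorphisms. A symmetric `B` is the coboundary of `(B(x, x) + l(x)) / 2` for every linear `l`. The
corresponding `η` has boundary exactly `(id, exp (2πi B))` when this function is integral on `L`,
that is, when `B(m, m) ≡ l(m)` modulo 2. The pairs `(B, l)` of this kind form the crossed module
`XiCover J` over `OTilde J`. It maps to `wActPlus` by the formula above, and to `Xi J` by `(B, l) ↦
l`, since `l² ≡ l` modulo 2 makes `B - l ⊗ l` even. Both strict morphisms induce equivalences
(`XiCover.toXi_isEquivalence`, `XiCover.toWActPlus_isEquivalence`), and the resulting span gives the
theorem. On `π₁`, the kernel of the boundary of `XiCover J` consists of the pairs `(0, 2l)`, which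
give the characters `exp (2πi l(x))`. -/

/-! ### Antiderivatives of analytic functions -/

/-- A real function whose derivative is analytic at a point is analytic there. -/
theorem AnalyticAt.of_hasDerivAt {h g : ℝ → ℝ} {x : ℝ} (hg : AnalyticAt ℝ g x)
    (hd : ∀ t, HasDerivAt h (g t) t) : AnalyticAt ℝ h x := by
  obtain ⟨p, r, hp⟩ := hg
  -- The power series of `g` is read with complex coefficients. On a disc its sum has a holomorphic
  -- primitive `H`. The real part of `H` along the real axis is analytic with derivative `g`, so it
  -- differs from `h` by a constant.
  set q : FormalMultilinearSeries ℂ ℂ ℂ :=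
    FormalMultilinearSeries.ofScalars ℂ (fun k => (p.coeff k : ℂ)) with hq
  have hrad : r ≤ q.radius := by
    refine hp.r_le.trans (FormalMultilinearSeries.radius_le_of_le fun k => ?_)
    simp [hq, FormalMultilinearSeries.norm_apply_eq_norm_coef]
  have hG := q.hasFPowerSeriesOnBall (lt_of_lt_of_le hp.r_pos hrad)
  obtain ⟨ε, hε0, hε⟩ := ENNReal.lt_iff_exists_nnreal_btwn.mp hp.r_pos
  have hε0' : (0 : ℝ) < ε := by exact_mod_cast hε0
  have hdiff : DifferentiableOn ℂ q.sum (Metric.ball (0 : ℂ) ε) := by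
    refine hG.differentiableOn.mono ?_
    rw [← Metric.eball_coe]
    exact Metric.eball_subset_eball (hε.le.trans hrad)
  obtain ⟨H, hH⟩ := hdiff.isExactOn_ball
  have hre : ∀ y : ℝ, |y| < ε → (q.sum (y : ℂ)).re = g (x + y) := fun y hy => by
    have hy' : y ∈ Metric.eball (0 : ℝ) r :=
      Metric.eball_subset_eball hε.le (by rw [Metric.eball_coe]; simpa using hy)
    have h1 := (Complex.hasSum_ofReal.mpr (hp.hasSum hy')).tsum_eq
    have h2 : q.sum (y : ℂ) = (g (x + y) : ℂ) := by
      rw [← h1, FormalMultilinearSeries.sum]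
      refine tsum_congr fun k => ?_
      simp [hq, mul_comm]
    rw [h2, Complex.ofReal_re]
  set ψ : ℝ → ℝ := fun t => (H ((t - x : ℝ) : ℂ)).re with hψ
  have hmem : ∀ t ∈ Metric.ball x ε, ((t - x : ℝ) : ℂ) ∈ Metric.ball (0 : ℂ) ε := fun t ht => by
    rw [mem_ball_zero_iff, Complex.norm_real]
    exact ht
  have hψd : ∀ t ∈ Metric.ball x ε, HasDerivAt ψ (g t) t := fun t ht => by
    have h1 := (hH _ (hmem t ht)).real_of_complex
    rw [hre _ (by simpa [Real.dist_eq] using ht)] at h1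
    have h2 := h1.comp t ((hasDerivAt_id t).sub_const x)
    simpa [hψ, Function.comp_def] using h2
  have hψa : AnalyticAt ℝ ψ x := by
    have h1 : DifferentiableOn ℂ H (Metric.ball (0 : ℂ) ε) := fun z hz =>
      (hH z hz).differentiableAt.differentiableWithinAt
    have h2 : AnalyticAt ℝ H ((x - x : ℝ) : ℂ) :=
      (h1.analyticAt (Metric.isOpen_ball.mem_nhds (hmem x (Metric.mem_ball_self hε0')))).restrictScalars
    have h3 : AnalyticAt ℝ (fun t : ℝ => ((t - x : ℝ) : ℂ)) x :=
      (Complex.ofRealCLM.analyticAt _).comp (analyticAt_id.sub analyticAt_const)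
    exact (Complex.reCLM.analyticAt _).comp (AnalyticAt.comp (f := fun t : ℝ => ((t - x : ℝ) : ℂ)) h2 h3)
  have hsub : ∀ t ∈ Metric.ball x ε, HasDerivAt (fun t => h t - ψ t) 0 t := fun t ht => by
    have h1 := (hd t).sub (hψd t ht)
    rw [sub_self] at h1
    exact h1
  have hconst : ∀ t ∈ Metric.ball x ε, h t - ψ t = h x - ψ x := fun t ht =>
    Metric.isOpen_ball.is_const_of_deriv_eq_zero (convex_ball x _).isPreconnected
      (fun s hs => (hsub s hs).differentiableAt.differentiableWithinAt)
      (fun s hs => (hsub s hs).deriv) ht (Metric.mem_ball_self hε0')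
  refine (hψa.add (analyticAt_const (v := h x - ψ x))).congr ?_
  filter_upwards [Metric.ball_mem_nhds x hε0'] with t ht
  have := hconst t ht
  simp only [Pi.add_apply]
  linarith

/-- An antiderivative of a `C^n` function is `C^n`, where `n` is `∞` or `ω`. -/
theorem ContDiff.of_hasDerivAt {n : WithTop ℕ∞} (hn : ∞ ≤ n) {h g : ℝ → ℝ} (hg : ContDiff ℝ n g)
    (hd : ∀ t, HasDerivAt h (g t) t) : ContDiff ℝ n h := by
  -- The only values with `∞ ≤ n` are `∞` and `ω`, and both absorb `1`.
  have hn' : n + 1 = n := by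
    induction n using WithTop.recTopCoe with
    | top => rfl
    | coe m => rw [top_le_iff.mp (WithTop.coe_le_coe.mp hn)]; rfl
  have hderiv : deriv h = g := funext fun t => (hd t).deriv
  rw [← hn', contDiff_succ_iff_deriv, hderiv]
  refine ⟨fun t => (hd t).differentiableAt, ?_, hg⟩
  -- For `n = ω` the criterion also asks for analyticity of `h` itself, which does not follow from
  -- that of `deriv h` by counting derivatives.
  rintro rfl t -
  exact (AnalyticAt.of_hasDerivAt (contDiff_omega_iff_analyticOnNhd.mp hg t trivial) hd).analyticWithinAt

/-! ### Lifting maps to the circle -/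

/-- A continuous lift exists because `W` is simply connected. Its regularity is a local matter, and
locally the lift is a branch of the logarithm. -/
theorem ContMDiff.exists_circle_lift {W : Type*} [NormedAddCommGroup W] [NormedSpace ℝ W]
    {n : WithTop ℕ∞} {g : W → Circle} (hg : ContMDiff 𝓘(ℝ, W) (𝓡 1) n g) (h0 : g 0 = 1) :
    ∃ h : W → ℝ, ContDiff ℝ n h ∧ h 0 = 0 ∧ ∀ x, g x = Circle.exp (2 * Real.pi * h x) := by
  obtain ⟨F, ⟨hF0, hF⟩, -⟩ := Circle.isCoveringMap_exp.existsUnique_continuousMap_lifts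
    ⟨g, hg.continuous⟩ (0 : W) (0 : ℝ) (by simp [h0])
  have hF' : ∀ x, Circle.exp (F x) = g x := fun x => congrFun hF x
  have := finrank_real_complex_fact'
  have hgc : ContDiff ℝ n fun x => (g x : ℂ) := by
    have : ContMDiff 𝓘(ℝ, W) 𝓘(ℝ, ℂ) n fun x => (g x : ℂ) := contMDiff_coe_sphere.comp hg
    exact this.contDiff
  refine ⟨fun x => F x / (2 * Real.pi), ?_, by simp [hF0], fun x => ?_⟩
  · refine ContDiff.div_const ?_ _
    rw [contDiff_iff_contDiffAt]
    intro x
    -- Dividing by `g x` moves the value at `x` to `1`, where the principal logarithm is smooth; for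
    -- `y` near `x` its imaginary part is `F y - F x`.
    have h1 : ContDiffAt ℝ n (fun y => (Complex.log ((g y : ℂ) / g x)).im) x := by
      have hl : ContDiffAt ℝ n Complex.log ((g x : ℂ) / g x) :=
        (Complex.contDiffAt_log (by simp)).restrict_scalars ℝ
      exact Complex.imCLM.contDiff.contDiffAt.comp x
        (hl.comp x (hgc.contDiffAt.div_const _))
    refine (h1.add (contDiffAt_const (c := F x))).congr_of_eventuallyEq ?_
    have h2 : ∀ᶠ y in nhds x, F y - F x ∈ Set.Ioo (-Real.pi) Real.pi := by
      have hc : Continuous fun y => F y - F x := by fun_prop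
      refine hc.continuousAt.eventually_mem (Ioo_mem_nhds ?_ ?_) <;> simp [Real.pi_pos]
    filter_upwards [h2] with y hy
    have h3 : (g y : ℂ) / g x = Complex.exp (((F y - F x : ℝ) : ℂ) * Complex.I) := by
      rw [← Circle.coe_exp, Circle.exp_sub, hF', hF', Circle.coe_div]
    rw [h3, Complex.log_exp (by simpa using hy.1) (by simpa using hy.2.le)]
    simp
  · rw [mul_div_cancel₀ _ (by positivity), hF']

/-! ### Uniqueness of lifts -/

/-- Uniqueness of lifts along the covering `ℝ → U(1)`. It promotes identities modulo `ℤ` to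
identities of real functions, given continuity and agreement at one point. -/
theorem eq_of_circleExp_eq {W : Type*} [TopologicalSpace W] [PreconnectedSpace W] {f g : W → ℝ}
    (hf : Continuous f) (hg : Continuous g)
    (h : ∀ x, Circle.exp (2 * Real.pi * f x) = Circle.exp (2 * Real.pi * g x)) (a : W)
    (ha : f a = g a) : f = g := by
  have h1 := Circle.isCoveringMap_exp.eq_of_comp_eq (g₁ := fun x => 2 * Real.pi * f x)
    (g₂ := fun x => 2 * Real.pi * g x) (by fun_prop) (by fun_prop) (funext h) a (by simp [ha])
  funext x
  exact mul_left_cancel₀ (by positivity) (congrFun h1 x)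

/-! ### Real valued cocycles -/

section Cocycle

/-- The 2-cocycle condition for real valued functions on an additive group. -/
def IsRealCocycle {V : Type*} [AddCommGroup V] (K : V → V → ℝ) : Prop :=
  ∀ x y z, K x y + K (x + y) z = K y z + K x (y + z)

namespace IsRealCocycle

theorem map_zero_right {V : Type*} [AddCommGroup V] {K : V → V → ℝ} (hK : IsRealCocycle K)
    (h0 : K 0 0 = 0) (x : V) : K x 0 = 0 := by
  have := hK x 0 0
  simp only [add_zero, h0] at this
  linarith

/-- In one dimension no symmetry is needed. With `g s = ∂₂K(s, 0)`, differentiating the cocycle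
identity in its last variable at `0` gives `∂₂K(s, t) = g (s + t) - g t`, so `h = ∫ g` has
coboundary `K`. -/
theorem exists_primitive_real {n : WithTop ℕ∞} (hn : ∞ ≤ n) {K : ℝ → ℝ → ℝ}
    (hK : IsRealCocycle K) (h0 : K 0 0 = 0) (hs : ContDiff ℝ n fun p : ℝ × ℝ => K p.1 p.2) :
    ∃ h : ℝ → ℝ, ContDiff ℝ n h ∧ ∀ s t, h (s + t) = h s + h t + K s t := by
  have hn1 : 1 ≤ n := le_trans (by exact_mod_cast le_top) hn
  have hnn : n + 1 ≤ n := by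
    induction n using WithTop.recTopCoe with
    | top => exact le_top
    | coe m => rw [top_le_iff.mp (WithTop.coe_le_coe.mp hn)]; exact le_rfl
  have hK1 : ∀ s t, HasDerivAt (K s) (fderiv ℝ (fun p : ℝ × ℝ => K p.1 p.2) (s, t) (0, 1)) t :=
    fun s t => by
      have h1 := (hs.differentiable (zero_lt_one.trans_le hn1).ne' (s, t)).hasFDerivAt
      exact h1.comp_hasDerivAt t ((hasDerivAt_const t s).prodMk (hasDerivAt_id t))
  set g : ℝ → ℝ := fun s => fderiv ℝ (fun p : ℝ × ℝ => K p.1 p.2) (s, 0) (0, 1) with hg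
  have hgs : ContDiff ℝ n g :=
    ((hs.fderiv_right hnn).comp (contDiff_id.prodMk contDiff_const)).clm_apply contDiff_const
  have hd : ∀ t, HasDerivAt (fun t => ∫ s in (0 : ℝ)..t, g s) (g t) t := fun t =>
    (hgs.continuous.integral_hasStrictDerivAt 0 t).hasDerivAt
  refine ⟨_, ContDiff.of_hasDerivAt hn hgs hd, fun s t => ?_⟩
  set h : ℝ → ℝ := fun t => ∫ s in (0 : ℝ)..t, g s with hh
  have hKd : ∀ t, HasDerivAt (K s) (g (s + t) - g t) t := fun t => by
    have h1 : HasDerivAt (fun u => K t u + K s (t + u) - K s t) (g t + _) 0 :=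
      ((hK1 t 0).add ((hK1 s (t + 0)).comp_const_add t 0)).sub_const _
    have h2 : (fun u => K t u + K s (t + u) - K s t) = fun u => K (s + t) u :=
      funext fun u => by linarith [hK s t u]
    rw [h2] at h1
    have h3 := (hK1 (s + t) 0).unique h1
    have h4 := hK1 s t
    rw [add_zero] at h3
    rwa [show g (s + t) - g t = _ from sub_eq_iff_eq_add'.mpr h3]
  -- The defect is constant in `t`; its value at `t = 0` is `h s`, since `h 0` and `K s 0` vanish.
  have hc : ∀ t, HasDerivAt (fun t => h (s + t) - h t - K s t) 0 t := fun t => by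
    have h1 := (((hd (s + t)).comp_const_add s t).sub (hd t)).sub (hKd t)
    rw [sub_self] at h1
    exact h1
  have h1 := is_const_of_deriv_eq_zero (fun t => (hc t).differentiableAt)
    (fun t => (hc t).deriv) t 0
  have h2 : h 0 = 0 := by simp [hh]
  have h3 := hK.map_zero_right h0 s
  simp only [add_zero, h2, h3] at h1
  linarith

/-- A symmetric cocycle describes an abelian extension of `V` by `ℝ`, which is split one coordinate
line at a time. -/
theorem exists_primitive {V : Type*} [NormedAddCommGroup V] [NormedSpace ℝ V]
    [FiniteDimensional ℝ V] {n : WithTop ℕ∞} (hn : ∞ ≤ n) {K : V → V → ℝ}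
    (hK : IsRealCocycle K) (h0 : K 0 0 = 0) (hsymm : ∀ x y, K x y = K y x)
    (hs : ContDiff ℝ n fun p : V × V => K p.1 p.2) :
    ∃ h : V → ℝ, ContDiff ℝ n h ∧ ∀ x y, h (x + y) = h x + h y + K x y := by
  classical
  set b := Module.finBasis ℝ V with hb
  have key : ∀ s : Finset (Fin (Module.finrank ℝ V)), ∃ h : V → ℝ, ContDiff ℝ n h ∧
      ∀ x y, h (x + y) = h x + h y + K (∑ i ∈ s, b.coord i x • b i) (∑ i ∈ s, b.coord i y • b i) := by
    intro s
    induction s using Finset.induction_on with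
    | empty => exact ⟨0, contDiff_const, fun x y => by simp [h0]⟩
    | insert i s hi ih =>
      obtain ⟨h, hh, hhK⟩ := ih
      have hcoord : ∀ i, ContDiff ℝ n (b.coord i) := fun i =>
        (LinearMap.toContinuousLinearMap (b.coord i)).contDiff
      obtain ⟨h', hh', hhK'⟩ := exists_primitive_real hn (K := fun s t => K (s • b i) (t • b i))
        (fun x y z => by simpa only [add_smul] using hK (x • b i) (y • b i) (z • b i))
        (by simpa using h0)
        (hs.comp ((contDiff_fst.smul contDiff_const).prodMk (contDiff_snd.smul contDiff_const)))
      have hP : ContDiff ℝ n fun x => ∑ i ∈ s, b.coord i x • b i :=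
        ContDiff.sum fun j _ => (hcoord j).smul contDiff_const
      -- Sections over the line and over the span of `s` are multiplied in the extension; the term
      -- `K p P` is the cost of writing the product over `p + P`.
      refine ⟨fun x => h x + h' (b.coord i x) +
          K (b.coord i x • b i) (∑ i ∈ s, b.coord i x • b i),
        (hh.add (hh'.comp (hcoord i))).add
          (hs.comp (((hcoord i).smul contDiff_const).prodMk hP)), fun x y => ?_⟩
      simp only [Finset.sum_insert hi, map_add, add_smul, Finset.sum_add_distrib, hhK, hhK']
      set p := b.coord i x • b i
      set q := b.coord i y • b i
      set P := ∑ i ∈ s, b.coord i x • b i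
      set Q := ∑ i ∈ s, b.coord i y • b i
      have e1 := hK p P (q + Q)
      have e2 := hK P q Q
      have e3 := hK p q (P + Q)
      have e4 := hK q P Q
      rw [show P + (q + Q) = q + (P + Q) by abel] at e1
      -- Symmetry enters only here, to let the lifts of `P` and `q` commute.
      rw [hsymm P q, add_comm P q] at e2
      linarith
  obtain ⟨h, hh, hhK⟩ := key Finset.univ
  refine ⟨h, hh, fun x y => ?_⟩
  have hx : ∀ x, ∑ i, b.coord i x • b i = x := b.sum_repr
  rw [hhK, hx, hx]

/-- The antisymmetrization is the commutator pairing of the central extension defined by `K`, hence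
biadditive. Continuity turns additivity into `ℝ`-linearity. -/
theorem exists_antisymmetrization {V : Type*} [NormedAddCommGroup V] [NormedSpace ℝ V]
    {K : V → V → ℝ} (hK : IsRealCocycle K) (hc : Continuous fun p : V × V => K p.1 p.2) :
    ∃ A : V →ₗ[ℝ] V →ₗ[ℝ] ℝ, ∀ x y, A x y = K x y - K y x := by
  have hadd : ∀ x y z, K (x + y) z - K z (x + y) = (K x z - K z x) + (K y z - K z y) :=
    fun x y z => by
      have e1 := hK x y z
      have e2 := hK z x y
      have e3 := hK x z y
      rw [add_comm z x] at e2
      rw [add_comm z y] at e3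
      linarith
  have hsmul : ∀ (c : ℝ) x z, K (c • x) z - K z (c • x) = c * (K x z - K z x) := fun c x z => by
    let f : V →+ ℝ := AddMonoidHom.mk' (fun x => K x z - K z x) fun x y => hadd x y z
    have hf : Continuous f :=
      (hc.comp (by fun_prop : Continuous fun x : V => (x, z))).sub
        (hc.comp (by fun_prop : Continuous fun x : V => (z, x)))
    exact map_real_smul f hf c x
  refine ⟨LinearMap.mk₂ ℝ (fun x y => K x y - K y x) hadd hsmul (fun x y z => ?_)
    (fun c x y => ?_), fun x y => rfl⟩
  · linarith [hadd y z x]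
  · have := hsmul c y x
    simp only [smul_eq_mul]
    linarith

end IsRealCocycle

end Cocycle

/-! ### Characters -/

section Lattice

variable {V : Type u} [NormedAddCommGroup V] [NormedSpace ℝ V]

theorem exists_linear_of_character {χ : V → Circle} (hχ : Continuous χ)
    (hadd : ∀ x y, χ (x + y) = χ x * χ y) :
    ∃ l : V →ₗ[ℝ] ℝ, ∀ x, χ x = Circle.exp (2 * Real.pi * l x) := by
  have h1 : χ 0 = 1 := by
    have := hadd 0 0
    rw [add_zero] at this
    exact left_eq_mul.mp this
  -- Regularity `0` suffices: a continuous additive lift is already linear.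
  obtain ⟨h, hh, h0, hχh⟩ := ContMDiff.exists_circle_lift (n := 0)
    (contMDiff_zero_iff.mpr hχ) h1
  have hc := hh.continuous
  have hadd' := eq_of_circleExp_eq (W := V × V) (f := fun p => h (p.1 + p.2))
    (g := fun p => h p.1 + h p.2) (by fun_prop) (by fun_prop)
    (fun p => by rw [← hχh, hadd, hχh, hχh, ← Circle.exp_add, mul_add]) (0, 0) (by simp [h0])
  let f : V →+ ℝ := AddMonoidHom.mk' h fun x y => congrFun hadd' (x, y)
  exact ⟨(f.toRealLinearMap hc).toLinearMap, hχh⟩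

variable (L : Submodule ℤ V) [DiscreteTopology L] [IsZLattice ℝ L]

theorem linearMap_ext_lattice {M : Type*} [AddCommGroup M] [Module ℝ M] {f g : V →ₗ[ℝ] M}
    (h : ∀ m : L, f m = g m) : f = g :=
  LinearMap.ext_on (IsZLattice.span_top (K := ℝ) (L := L)) fun x hx => h ⟨x, hx⟩

theorem bilin_ext_lattice {f g : V →ₗ[ℝ] V →ₗ[ℝ] ℝ} (h : ∀ m m' : L, f m m' = g m m') : f = g :=
  linearMap_ext_lattice L fun m => linearMap_ext_lattice L fun m' => h m m'

variable [FiniteDimensional ℝ V]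

/-- A `ℤ`-basis of `L` is an `ℝ`-basis of `V`, so logarithms of the values can be prescribed on it.
-/
theorem exists_linear_of_lattice_character {φ : L → Circle} (hφ : ∀ m m', φ (m + m') = φ m * φ m') :
    ∃ l : V →ₗ[ℝ] ℝ, ∀ m : L, φ m = Circle.exp (2 * Real.pi * l m) := by
  let b := Module.Free.chooseBasis ℤ L
  let l := (b.ofZLatticeBasis ℝ L).constr ℝ fun i => Complex.arg (φ (b i)) / (2 * Real.pi)
  let f : L →+ Additive Circle := AddMonoidHom.mk' (fun m => .ofMul (φ m)) fun m m' => hφ m m'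
  let g : L →+ Additive Circle :=
    AddMonoidHom.mk' (fun m : L => .ofMul (Circle.exp (2 * Real.pi * l m))) fun m m' => by
      rw [Submodule.coe_add, map_add, mul_add, Circle.exp_add]; rfl
  have hfg : f.toIntLinearMap = g.toIntLinearMap := b.ext fun i => by
    change Additive.ofMul (φ (b i)) = .ofMul (Circle.exp (2 * Real.pi * l (b i : V)))
    have h1 : l (b i : V) = Complex.arg (φ (b i)) / (2 * Real.pi) := by
      rw [← Module.Basis.ofZLatticeBasis_apply ℝ L, Module.Basis.constr_basis]
    rw [h1, mul_div_cancel₀ _ (by positivity), Circle.exp_arg]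
  exact ⟨l, fun m => LinearMap.congr_fun hfg m⟩

theorem exists_dualExt_eq {l : V →ₗ[ℝ] ℝ} (hl : ∀ m : L, ∃ k : ℤ, l m = k) :
    ∃ l' : Module.Dual ℤ L, dualExt L l' = l := by
  choose k hk using hl
  let l' : L →+ ℤ := AddMonoidHom.mk' k fun m m' => by
    have : ((k (m + m') : ℤ) : ℝ) = k m + k m' := by
      rw [← hk, ← hk, ← hk, Submodule.coe_add, map_add]
    exact_mod_cast this
  refine ⟨l'.toIntLinearMap, linearMap_ext_lattice L fun m => ?_⟩
  rw [dualExt_coe, hk]; rfl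

end Lattice

/-! ### Morphisms of crossed modules -/

namespace CrossedModule

universe u₀ u₁ v₀ v₁

/-- A (strict) morphism of crossed modules. -/
structure Morphism {G₀ : Type u₀} {G₁ : Type u₁} {H₀ : Type v₀} {H₁ : Type v₁} [Group G₀] [Group G₁]
    [Group H₀] [Group H₁] (Ψ : CrossedModule G₀ G₁) (Φ : CrossedModule H₀ H₁) where
  hom₀ : G₀ →* H₀
  hom₁ : G₁ →* H₁
  bd_hom₁ : ∀ α, Φ.bd (hom₁ α) = hom₀ (Ψ.bd α)
  hom₁_act : ∀ α x, hom₁ (Ψ.act α x) = Φ.act (hom₁ α) (hom₀ x)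

namespace Morphism

open CatGroup

variable {G₀ : Type u₀} {G₁ : Type u₁} {H₀ : Type v₀} {H₁ : Type v₁} [Group G₀] [Group G₁]
    [Group H₀] [Group H₁] {Ψ : CrossedModule G₀ G₁} {Φ : CrossedModule H₀ H₁} (φ : Morphism Ψ Φ)

/-- The functor induced by a morphism of crossed modules. -/
def functor : Ψ.CatGroup ⥤ Φ.CatGroup where
  obj x := ⟨φ.hom₀ x.of⟩
  map {x y} a := homMk (φ.hom₁ (label a)) (by
    change φ.hom₀ x.of * _ = φ.hom₀ y.of
    rw [φ.bd_hom₁, ← map_mul, of_mul_bd_label])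
  map_id x := by ext; simp
  map_comp a b := by ext; simp

@[simp] theorem label_functor_map {x y : Ψ.CatGroup} (a : x ⟶ y) :
    label (φ.functor.map a) = φ.hom₁ (label a) := rfl

instance : φ.functor.Monoidal := Functor.CoreMonoidal.toMonoidal
  { εIso := isoOfEq (map_one φ.hom₀).symm
    μIso := fun x y => isoOfEq (map_mul φ.hom₀ x.of y.of).symm
    μIso_hom_natural_left := fun a z => by
      ext; simp only [label_comp, label_whiskerRight, label_functor_map, φ.hom₁_act]
      exact (mul_one _).trans (one_mul _).symm
    μIso_hom_natural_right := fun z a => by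
      ext; simp only [label_comp, label_whiskerLeft, label_functor_map]
      exact (mul_one _).trans (one_mul _).symm
    associativity := fun x y z => by
      ext; simp only [label_comp, label_whiskerRight, label_whiskerLeft, label_functor_map,
        label_associator_hom, map_one, mul_one, one_mul]
      exact congrArg (· * (1 : H₁)) (Φ.one_act _)
    left_unitality := fun x => by
      ext; simp only [label_comp, label_whiskerRight, label_functor_map, label_leftUnitor_hom,
        map_one, mul_one]
      exact (mul_one (1 : H₁)).symm.trans (congrArg (· * (1 : H₁)) (Φ.one_act _)).symm
    right_unitality := fun x => by
      ext; simp only [label_comp, label_whiskerLeft, label_functor_map, label_rightUnitor_hom,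
        map_one, mul_one]
      exact (mul_one (1 : H₁)).symm }

/-- Arrows `x ⟶ y` are the `α` with `bd α = x⁻¹ * y`. The first two hypotheses therefore say that
`hom₁` is bijective from each fibre of `Ψ.bd` to the corresponding fibre of `Φ.bd`; the third is
essential surjectivity. -/
theorem isEquivalence (hinj : ∀ α β, Ψ.bd α = Ψ.bd β → φ.hom₁ α = φ.hom₁ β → α = β)
    (hfull : ∀ x β, φ.hom₀ x = Φ.bd β → ∃ α, Ψ.bd α = x ∧ φ.hom₁ α = β)
    (hsurj : ∀ y, ∃ x β, φ.hom₀ x * Φ.bd β = y) : φ.functor.IsEquivalence where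
  faithful := ⟨fun {x y a b} h => by
    ext
    refine hinj _ _ ?_ (congrArg label h)
    exact mul_left_cancel ((of_mul_bd_label a).trans (of_mul_bd_label b).symm)⟩
  full := ⟨fun {x y} b => by
    obtain ⟨α, hα, hβ⟩ := hfull (x.of⁻¹ * y.of) (label b) (by
      have h := of_mul_bd_label b
      rw [map_mul, map_inv, inv_mul_eq_iff_eq_mul]
      exact h.symm)
    exact ⟨homMk α (by rw [hα, mul_inv_cancel_left]), by ext; exact hβ⟩⟩
  essSurj := ⟨fun y => by
    obtain ⟨x, β, h⟩ := hsurj y.of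
    exact ⟨⟨x⟩, ⟨(Groupoid.isoEquivHom _ _).symm (homMk β h)⟩⟩⟩

end Morphism

end CrossedModule

/-! ### Automorphisms of the unit object, and spans of monoidal equivalences. -/

namespace CrossedModule.CatGroup

/-- The automorphisms of the unit object form the kernel of the boundary map. -/
theorem exists_aut_mulEquiv {G₀ G₁ A : Type*} [Group G₀] [Group G₁] [CommGroup A]
    {Ψ : CrossedModule G₀ G₁} (θ : A →* G₁) (hθ : Function.Injective θ) (hbd : ∀ a, Ψ.bd (θ a) = 1)
    (hsurj : ∀ α, Ψ.bd α = 1 → ∃ a, θ a = α) :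
    ∃ e : A ≃* Aut (𝟙_ Ψ.CatGroup), ∀ a, label (e a).hom = θ a := by
  let g : A →* Aut (𝟙_ Ψ.CatGroup) := MonoidHom.mk'
    (fun a => (Groupoid.isoEquivHom _ _).symm (homMk (θ a) (by rw [hbd, mul_one])))
    -- Multiplication in `Aut` composes in the reverse order, which commutativity of `A` absorbs.
    fun a b => Iso.ext (hom_ext ((congrArg θ (mul_comm a b)).trans (map_mul θ b a)))
  have hg : ∀ a, label (g a).hom = θ a := fun a => rfl
  refine ⟨MulEquiv.ofBijective g ⟨fun a b h => hθ ?_, fun x => ?_⟩, hg⟩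
  · rw [← hg, ← hg, h]
  · have h := of_mul_bd_label x.hom
    rw [of_tensorUnit, one_mul] at h
    obtain ⟨a, ha⟩ := hsurj _ h
    exact ⟨a, Iso.ext (hom_ext ((hg a).trans ha))⟩

/-- A form of `exists_aut_mulEquiv` that composes with a further isomorphism. -/
theorem exists_aut_mulEquiv_of_rel {G₀ G₁ A C : Type*} [Group G₀] [Group G₁] [CommGroup A] [Mul C]
    {Ψ : CrossedModule G₀ G₁} (θ : A →* G₁) (hθ : Function.Injective θ) (hbd : ∀ a, Ψ.bd (θ a) = 1)
    (hsurj : ∀ α, Ψ.bd α = 1 → ∃ a, θ a = α) {P : G₁ → C → Prop}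
    (hc : ∃ c : A ≃* C, ∀ a, P (θ a) (c a)) :
    ∃ e : Aut (𝟙_ Ψ.CatGroup) ≃* C, ∀ a, P (label a.hom) (e a) := by
  obtain ⟨c, hc⟩ := hc
  obtain ⟨e, he⟩ := exists_aut_mulEquiv θ hθ hbd hsurj
  refine ⟨e.symm.trans c, fun a => ?_⟩
  obtain ⟨a, rfl⟩ := e.surjective a
  rw [he, MulEquiv.trans_apply, MulEquiv.symm_apply_apply]
  exact hc a

end CrossedModule.CatGroup

/-- A quasi-inverse of a monoidal equivalence is monoidal, so it suffices to have strict morphisms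
out of a common cover. -/
theorem CategoryTheory.Functor.exists_monoidal_equivalence_of_span {A B C : Type*} [Category A]
    [Category B] [Category C] [MonoidalCategory A] [MonoidalCategory B] [MonoidalCategory C]
    (F : A ⥤ B) (G : A ⥤ C) [F.Monoidal] [G.Monoidal] [F.IsEquivalence] [G.IsEquivalence] :
    ∃ H : B ⥤ C, H.IsEquivalence ∧ Nonempty H.Monoidal := by
  let e := F.asEquivalence
  let : e.functor.Monoidal := ‹F.Monoidal›
  let := e.inverseMonoidal
  exact ⟨e.inverse ⋙ G, inferInstance, ⟨inferInstance⟩⟩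

/-! ### A crossed module covering `Ξ` -/

section XiCover

variable {L : Type u} [AddCommGroup L] [Module ℤ L]

variable (L) in
/-- The pairs `(B, l)` of a symmetric form and a linear form with `B m m ≡ l m` modulo `2`. -/
def parityPairs : AddSubgroup (LinearMap.BilinForm ℤ L × Module.Dual ℤ L) where
  carrier := {p | (∀ m n, p.1 m n = p.1 n m) ∧ ∀ m, Even (p.1 m m + p.2 m)}
  zero_mem' := ⟨fun _ _ => rfl, fun _ => Even.zero⟩
  add_mem' {p q} hp hq := ⟨fun m n => congrArg₂ (· + ·) (hp.1 m n) (hq.1 m n), fun m => by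
    have h := (hp.2 m).add (hq.2 m)
    rw [add_add_add_comm] at h
    exact h⟩
  neg_mem' {p} hp := ⟨fun m n => congrArg Neg.neg (hp.1 m n), fun m => by
    have h := (hp.2 m).neg
    rw [neg_add] at h
    exact h⟩

/-- The crossed module with boundary `(B, l) ↦ (id, B)`. -/
def XiCover (J : LinearMap.BilinForm ℤ L) :
    CrossedModule (OTilde J) (Multiplicative (parityPairs L)) where
  bd := MonoidHom.mk' (fun p => ⟨1, p.toAdd.1.1, by
    ext m n
    simp [p.toAdd.2.1 m n]⟩) fun p q => rfl
  act p a := .ofAdd ⟨(pullForm p.toAdd.1.1 a.f.1, p.toAdd.1.2 ∘ₗ a.f.1.toLinearMap),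
    fun m n => p.toAdd.2.1 _ _, fun m => p.toAdd.2.2 _⟩
  act_one p := rfl
  act_mul p a b := rfl
  mul_act p q a := rfl
  bd_act p a := by
    rw [mul_assoc, eq_inv_mul_iff_mul_eq]
    apply OTilde.ext
    · exact (mul_one _).trans (one_mul _).symm
    · exact LinearMap.ext₂ fun m n => add_comm _ _
  peiffer p q := by
    rw [mul_comm _ q, inv_mul_cancel_right]
    rfl

/-- The projection to `Ξ`. -/
def XiCover.toXi (J : LinearMap.BilinForm ℤ L) : CrossedModule.Morphism (XiCover J) (Xi J) where
  hom₀ := QuotientGroup.mk' _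
  hom₁ := MonoidHom.mk' (fun p => .ofAdd p.toAdd.1.2) fun p q => rfl
  bd_hom₁ p := by
    refine QuotientGroup.eq.mpr
      (?_ : (OTilde.square J p.toAdd.1.2)⁻¹ * (XiCover J).bd p ∈ OTilde.evenSubgroup J)
    have key : ∀ m n, ((OTilde.square J p.toAdd.1.2)⁻¹ * (XiCover J).bd p).B m n =
        -(p.toAdd.1.2 m * p.toAdd.1.2 n) + p.toAdd.1.1 m n := fun m n => rfl
    refine ⟨rfl, fun m n => ?_, fun m => ?_⟩
    · rw [key, key, p.toAdd.2.1 m n, mul_comm]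
    · rw [key]
      have h := p.toAdd.2.2 m
      -- Since `l² ≡ l` modulo 2, the parity condition makes `B - l ⊗ l` even.
      have h' : Even (p.toAdd.1.2 m * (p.toAdd.1.2 m + 1)) := Int.even_mul_succ_self _
      rw [show -(p.toAdd.1.2 m * p.toAdd.1.2 m) + p.toAdd.1.1 m m =
        (p.toAdd.1.1 m m + p.toAdd.1.2 m) - p.toAdd.1.2 m * (p.toAdd.1.2 m + 1) by ring]
      exact h.sub h'
  hom₁_act p a := rfl

/-- `XiCover J` is the pull-back of `Xi J` along the surjection from `OTilde J` to `EGroup J`: a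
pair `(a, l)` with `[a] = [(id, l ⊗ l)]` is the same as a parity pair `(B, l)`. -/
theorem XiCover.toXi_isEquivalence (J : LinearMap.BilinForm ℤ L) :
    (XiCover.toXi J).functor.IsEquivalence := by
  refine CrossedModule.Morphism.isEquivalence _ (fun p q hB hl => ?_) (fun a l h => ?_)
    (fun y => ?_)
  · exact Multiplicative.toAdd.injective (Subtype.ext (Prod.ext (congrArg OTilde.B hB)
      (Multiplicative.ofAdd.injective hl)))
  · have h' : (OTilde.square J l.toAdd)⁻¹ * a ∈ OTilde.evenSubgroup J :=
      QuotientGroup.eq.mp h.symm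
    obtain ⟨h1, h2, h3⟩ := h'
    have hf : a.f = 1 := by
      rwa [OTilde.mul_f, show (OTilde.square J l.toAdd)⁻¹.f = 1 from inv_one, one_mul] at h1
    have key : ∀ m n, ((OTilde.square J l.toAdd)⁻¹ * a).B m n =
        -(l.toAdd m * l.toAdd n) + a.B m n := fun m n => by
      rw [OTilde.mul_B_apply, hf]; rfl
    simp only [key] at h2 h3
    refine ⟨.ofAdd ⟨(a.B, l.toAdd), fun m n => ?_, fun m => ?_⟩, OTilde.ext hf.symm rfl, rfl⟩
    · have := h2 m n
      change a.B m n = a.B n m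
      linarith [mul_comm (l.toAdd m) (l.toAdd n)]
    · have h' : Even (l.toAdd m * (l.toAdd m + 1)) := Int.even_mul_succ_self _
      change Even (a.B m m + l.toAdd m)
      rw [show a.B m m + l.toAdd m =
        (-(l.toAdd m * l.toAdd m) + a.B m m) + l.toAdd m * (l.toAdd m + 1) by ring]
      exact (h3 m).add h'
  · induction y using QuotientGroup.induction_on with
    | H a => exact ⟨a, 1, by rw [map_one, mul_one]; rfl⟩

/-- Preservation of `J + Jᵗ` makes `A = J - f^*J` skew, with zero diagonal because `ℤ` has no
2-torsion. The strictly upper triangular part `B` of `A` in an ordered basis satisfies `B - Bᵗ = A`.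
-/
theorem OTilde.exists_of_isometry [Module.Free ℤ L] (J : LinearMap.BilinForm ℤ L)
    (f : isometryGroup (J + J.flip)) : ∃ a : OTilde J, a.f = f := by
  classical
  let b := Module.Free.chooseBasis ℤ L
  let : LinearOrder (Module.Free.ChooseBasisIndex ℤ L) := linearOrderOfSTO WellOrderingRel
  set A : LinearMap.BilinForm ℤ L := J - pullForm J f.1 with hA
  have hskew : ∀ m n, A m n = -A n m := fun m n => by
    have h := f.2 m n
    simp only [hA, LinearMap.sub_apply, LinearMap.add_apply, LinearMap.BilinForm.flip_apply,
      pullForm_apply] at h ⊢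
    linarith
  refine ⟨⟨f, b.constr ℤ fun i => b.constr ℤ fun j => if i < j then A (b i) (b j) else 0, ?_⟩, rfl⟩
  refine b.ext fun i => b.ext fun j => ?_
  change _ = A _ _
  simp only [LinearMap.sub_apply, LinearMap.BilinForm.flip_apply, Module.Basis.constr_basis]
  rcases lt_trichotomy i j with h | rfl | h
  · simp [h, h.not_gt]
  · have := hskew (b i) (b i)
    simp only [lt_irrefl, if_false, sub_zero]
    linarith
  · rw [hskew]
    simp [h, h.not_gt]

end XiCover

/-! ### Structure of weak endomorphisms of `Θ`. -/

section ThetaAnalysis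

/-- A pointed continuous map from a connected space to `L × U(1)` has trivial first component. -/
theorem fst_eq_one_of_continuous {V : Type*} [NormedAddCommGroup V] {L : Submodule ℤ V}
    [DiscreteTopology L] {W : Type*} [TopologicalSpace W] [PreconnectedSpace W]
    {g : W → Multiplicative L × Circle} (hg : Continuous g) (a : W) (ha : (g a).1 = 1) (x : W) :
    (g x).1 = 1 := by
  have : DiscreteTopology (Multiplicative L) := inferInstanceAs (DiscreteTopology L)
  rw [← ha]
  exact PreconnectedSpace.constant ‹_› (continuous_fst.comp hg)

variable {V : Type u} [NormedAddCommGroup V] [NormedSpace ℝ V] [FiniteDimensional ℝ V]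
  {L : Submodule ℤ V} [DiscreteTopology L] [IsZLattice ℝ L] {J : LinearMap.BilinForm ℤ L}
  {n : WithTop ℕ∞}

theorem PointedMap.fst_eq_one (η : PointedMap (Theta L n J)) (x : Multiplicative V) :
    (η x).1 = 1 := by
  have : PreconnectedSpace (Multiplicative V) := inferInstanceAs (PreconnectedSpace V)
  exact fst_eq_one_of_continuous η.contMDiff.continuous 1 (by rw [η.map_one]; rfl) x

theorem WeakEnd.κ_fst_eq_one (u : WeakEnd (Theta L n J)) (x y : Multiplicative V) :
    (u.κ x y).1 = 1 := by
  have : PreconnectedSpace (Multiplicative V × Multiplicative V) :=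
    inferInstanceAs (PreconnectedSpace (V × V))
  exact fst_eq_one_of_continuous u.contMDiff_κ.continuous (1, 1) (by rw [u.κ_one_one]; rfl) (x, y)

theorem Theta_bd (α : Multiplicative L × Circle) :
    (Theta L n J).bd α = .ofAdd (α.1.toAdd : V) := rfl

theorem Theta_bd_of_fst {α : Multiplicative L × Circle} (h : α.1 = 1) :
    (Theta L n J).bd α = 1 := by
  rw [Theta_bd, h]; rfl

theorem Theta_act_of_fst {α : Multiplicative L × Circle} (h : α.1 = 1) (x : Multiplicative V) :
    (Theta L n J).act α x = α := by
  refine Prod.ext rfl ?_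
  change α.2 * Circle.exp (2 * Real.pi * formExt L J (α.1.toAdd : V) x.toAdd) = α.2
  rw [h]
  simp

namespace WeakEnd

theorem f₀_mul (u : WeakEnd (Theta L n J)) (x y : Multiplicative V) :
    u.f₀ (x * y) = u.f₀ x * u.f₀ y := by
  rw [← u.w2, Theta_bd_of_fst (u.κ_fst_eq_one x y), mul_one]

/-- The linear map on `V` underlying a weak endomorphism of `Θ`. -/
noncomputable def linear (u : WeakEnd (Theta L n J)) : V →ₗ[ℝ] V :=
  (AddMonoidHom.toRealLinearMap
    (AddMonoidHom.mk' (fun x : V => (u.f₀ (.ofAdd x)).toAdd) fun _ _ => u.f₀_mul _ _)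
    u.contMDiff_f₀.continuous).toLinearMap

/-- The endomorphism of `L` underlying a weak endomorphism of `Θ`. -/
noncomputable def latticeEnd (u : WeakEnd (Theta L n J)) : L →ₗ[ℤ] L :=
  AddMonoidHom.toIntLinearMap (AddMonoidHom.mk' (fun m => (u.f₁ (.ofAdd m, 1)).1.toAdd)
    fun m m' => Subtype.ext (by
      have h : ∀ m : L, ((u.f₁ (.ofAdd m, 1)).1.toAdd : V) = u.linear m := fun m =>
        (congrArg Multiplicative.toAdd (u.w1 (.ofAdd m, 1))).symm
      rw [Submodule.coe_add, h, h, h, Submodule.coe_add, map_add]))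

theorem latticeEnd_apply (u : WeakEnd (Theta L n J)) (m : L) :
    u.latticeEnd m = (u.f₁ (.ofAdd m, 1)).1.toAdd := rfl

theorem linear_coe (u : WeakEnd (Theta L n J)) (m : L) : u.linear m = (u.latticeEnd m : V) :=
  congrArg Multiplicative.toAdd (u.w1 (.ofAdd m, 1))

theorem f₁_fst (u : WeakEnd (Theta L n J)) (α : Multiplicative L × Circle) :
    (u.f₁ α).1 = .ofAdd (u.latticeEnd α.1.toAdd) := by
  have h : (((u.f₁ α).1.toAdd : L) : V) = u.latticeEnd α.1.toAdd := by
    rw [← linear_coe]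
    exact (congrArg Multiplicative.toAdd (u.w1 α)).symm
  exact Multiplicative.toAdd.injective (Subtype.ext h)

variable (L n J) in
/-- The action of weak endomorphisms on the lattice. -/
noncomputable def latticeHom : WeakEnd (Theta L n J) →* Module.End ℤ L where
  toFun := latticeEnd
  map_one' := rfl
  map_mul' u v := LinearMap.ext fun m => Subtype.ext (by
    rw [Module.End.mul_apply, ← linear_coe, ← linear_coe, ← linear_coe]; rfl)

/-- The real cocycle of a weak endomorphism. -/
theorem exists_real_cocycle (u : WeakEnd (Theta L n J)) :
    ∃ K : V → V → ℝ, ContDiff ℝ n (fun p : V × V => K p.1 p.2) ∧ K 0 0 = 0 ∧ IsRealCocycle K ∧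
      ∀ x y : V, u.κ (.ofAdd x) (.ofAdd y) = (1, Circle.exp (2 * Real.pi * K x y)) := by
  have h1 : ContMDiff 𝓘(ℝ, V × V) (𝓘(ℝ, V).prod 𝓘(ℝ, V)) n
      fun p : V × V => ((.ofAdd p.1, .ofAdd p.2) : Multiplicative V × Multiplicative V) :=
    (contDiff_fst.contMDiff : ContMDiff 𝓘(ℝ, V × V) 𝓘(ℝ, V) n fun p : V × V => p.1).prodMk
      (contDiff_snd.contMDiff : ContMDiff 𝓘(ℝ, V × V) 𝓘(ℝ, V) n fun p : V × V => p.2)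
  have h2 : ContMDiff 𝓘(ℝ, V × V) (𝓡 1) n fun p : V × V => (u.κ (.ofAdd p.1) (.ofAdd p.2)).2 :=
    (contMDiff_snd.comp u.contMDiff_κ).comp h1
  obtain ⟨K, hK, hK0, hκ⟩ := h2.exists_circle_lift (by
    change (u.κ 1 1).2 = 1
    rw [u.κ_one_one]; rfl)
  have hKc := hK.continuous
  refine ⟨fun x y => K (x, y), hK, hK0, ?_, fun x y =>
    Prod.ext (u.κ_fst_eq_one _ _) (hκ (x, y))⟩
  -- Since `V` acts trivially on `U(1)`, the axiom `w4` is the cocycle identity modulo `ℤ`;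
  -- continuity and the value at the origin make it exact.
  have h := eq_of_circleExp_eq (W := V × V × V)
    (f := fun p => K (p.1, p.2.1) + K (p.1 + p.2.1, p.2.2))
    (g := fun p => K (p.2.1, p.2.2) + K (p.1, p.2.1 + p.2.2)) (by fun_prop) (by fun_prop)
    (fun p => by
      have h4 := congrArg Prod.snd (u.w4 (.ofAdd p.1) (.ofAdd p.2.1) (.ofAdd p.2.2))
      rw [Theta_act_of_fst (u.κ_fst_eq_one _ _)] at h4
      simp only [mul_add, Circle.exp_add, ← hκ]
      exact h4) (0, 0, 0) (by simp)
  exact fun x y z => congrFun h (x, y, z)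

/-- Equivariance `w5` for `(m, 1)` and `y` gives the identity modulo `ℤ` when the first argument `m`
lies in `L`. Both sides are linear in `y`, so they agree exactly, and `L` spans `V`. -/
theorem antisymmetrization_eq (u : WeakEnd (Theta L n J))
    {K : V → V → ℝ} (hc : Continuous (fun p : V × V => K p.1 p.2)) (hK : IsRealCocycle K)
    (hu : ∀ z : Circle, u.f₁ (1, z) = (1, z))
    (hκ : ∀ x y : V, u.κ (.ofAdd x) (.ofAdd y) = (1, Circle.exp (2 * Real.pi * K x y))) (x y : V) :
    K x y - K y x = formExt L J x y - formExt L J (u.linear x) (u.linear y) := by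
  obtain ⟨A, hA⟩ := hK.exists_antisymmetrization hc
  -- This pulls the phase `exp (2πi J(m, y))` of `(m, 1) ^ y` out of `f₁`.
  have hf₁ : ∀ m z, u.f₁ (m, z) = u.f₁ (m, 1) * (1, z) := fun m z => by
    have h3 := u.w3 (m, 1) (1, z)
    rw [Theta_bd_of_fst (α := (1, z)) rfl, u.κ_one_right, mul_one, hu] at h3
    rw [h3]
    simp
  have key : A = formExt L J - (formExt L J).compl₁₂ u.linear u.linear := by
    refine linearMap_ext_lattice L fun m => ?_
    have h5 : ∀ y : V, Circle.exp (2 * Real.pi * A m y) = Circle.exp (2 * Real.pi *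
        (formExt L J - (formExt L J).compl₁₂ u.linear u.linear) m y) := fun y => by
      have h := congrArg Prod.snd (u.w5 (.ofAdd m, 1) (.ofAdd y))
      have e1 : ((Theta L n J).act (u.f₁ (.ofAdd m, 1)) (u.f₀ (.ofAdd y))).2 =
          (u.f₁ (.ofAdd m, 1)).2 *
            Circle.exp (2 * Real.pi * formExt L J (u.linear m) (u.linear y)) := by
        rw [linear_coe]; rfl
      have e2 : (Theta L n J).act (.ofAdd m, 1) (.ofAdd y) =
          (.ofAdd m, Circle.exp (2 * Real.pi * formExt L J m y)) :=
        Prod.ext rfl (one_mul _)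
      rw [Prod.snd_mul, Prod.snd_mul, e1, e2, hf₁ _ (Circle.exp _), Theta_bd, Theta_bd, hκ, hκ] at h
      change (u.f₁ (.ofAdd m, 1)).2 *
          Circle.exp (2 * Real.pi * formExt L J (u.linear m) (u.linear y)) *
            Circle.exp (2 * Real.pi * K m y) =
        (u.f₁ (.ofAdd m, 1)).2 * Circle.exp (2 * Real.pi * formExt L J m y) *
          Circle.exp (2 * Real.pi * K y m) at h
      rw [mul_assoc (u.f₁ _).2, mul_assoc (u.f₁ _).2, mul_right_inj, ← Circle.exp_add,
        ← Circle.exp_add] at h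
      obtain ⟨k, hk⟩ := Circle.exp_eq_exp.mp h
      refine Circle.exp_eq_exp.mpr ⟨k, ?_⟩
      simp only [hA, LinearMap.sub_apply, LinearMap.compl₁₂_apply] at hk ⊢
      linarith
    ext y
    exact congrFun (eq_of_circleExp_eq (LinearMap.continuous_of_finiteDimensional (A m))
      (LinearMap.continuous_of_finiteDimensional
        ((formExt L J - (formExt L J).compl₁₂ u.linear u.linear) m)) h5 0 (by simp)) y
  rw [← hA, key]
  rfl

/-- The antisymmetrization of `K` changes sign when its arguments are exchanged, hence so does `J -
f^*J`, and adding the two orders leaves zero. -/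
theorem latticeEnd_isometry (u : WeakEnd (Theta L n J))
    (hu : ∀ z : Circle, u.f₁ (1, z) = (1, z)) (m m' : L) :
    (J + J.flip) (u.latticeEnd m) (u.latticeEnd m') = (J + J.flip) m m' := by
  obtain ⟨K, hs, -, hK, hκ⟩ := u.exists_real_cocycle
  have h1 := u.antisymmetrization_eq hs.continuous hK hu hκ m m'
  have h2 := u.antisymmetrization_eq hs.continuous hK hu hκ m' m
  simp only [linear_coe, formExt_coe] at h1 h2
  simp only [LinearMap.add_apply, LinearMap.BilinForm.flip_apply]
  have h3 : ((J (u.latticeEnd m) (u.latticeEnd m') + J (u.latticeEnd m') (u.latticeEnd m) : ℤ) : ℝ)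
      = (J m m' + J m' m : ℤ) := by
    push_cast
    linarith
  exact_mod_cast h3

end WeakEnd

variable (n J) in
/-- The pointed map `x ↦ (0, exp (2 π i h x))`. -/
noncomputable def PointedMap.ofReal {h : V → ℝ} (hh : ContDiff ℝ n h) (h0 : h 0 = 0) :
    PointedMap (Theta L n J) where
  toFun x := (1, Circle.exp (2 * Real.pi * h x.toAdd))
  contMDiff := by
    have h1 : ContMDiff 𝓘(ℝ, V) 𝓘(ℝ, ℝ) n fun x : Multiplicative V => 2 * Real.pi * h x.toAdd :=
      (contDiff_const.mul hh).contMDiff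
    exact contMDiff_const.prodMk (contMDiff_circleExp.comp h1)
  map_one := by
    rw [toAdd_one, h0, mul_zero, Circle.exp_zero]; rfl

theorem PointedMap.ofReal_apply {h : V → ℝ} (hh : ContDiff ℝ n h) (h0 : h 0 = 0)
    (x : Multiplicative V) :
    ofReal (L := L) J n hh h0 x = (1, Circle.exp (2 * Real.pi * h x.toAdd)) := rfl

theorem PointedMap.theta_mul_apply (η ζ : PointedMap (Theta L n J)) (x : Multiplicative V) :
    (η * ζ) x = ζ x * η x := by
  rw [mul_apply, Theta_bd_of_fst (ζ.fst_eq_one x), mul_one]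

theorem PointedMap.theta_isUnit (η : PointedMap (Theta L n J)) : IsUnit η := by
  let ζ : PointedMap (Theta L n J) :=
    ⟨fun x => (η x)⁻¹, η.contMDiff.inv, by rw [η.map_one, inv_one]⟩
  refine ⟨⟨η, ζ, ?_, ?_⟩, rfl⟩
  · ext1; funext x
    rw [theta_mul_apply]
    exact inv_mul_cancel _
  · ext1; funext x
    rw [theta_mul_apply]
    exact mul_inv_cancel _

/-- A weak endomorphism that is the identity on `U(1)` and on the lattice lies in the image
of `delta`. -/
theorem WeakEnd.exists_delta_eq (hn : ∞ ≤ n) (u : WeakEnd (Theta L n J))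
    (hu : ∀ z : Circle, u.f₁ (1, z) = (1, z)) (hL : ∀ m, u.latticeEnd m = m) :
    ∃ η : PointedMap (Theta L n J), PointedMap.delta η = u := by
  obtain ⟨K, hs, hK0, hK, hκ⟩ := u.exists_real_cocycle
  have hlin : u.linear = LinearMap.id := linearMap_ext_lattice L fun m => by
    rw [linear_coe, hL]; rfl
  have hsymm : ∀ x y, K x y = K y x := fun x y => by
    have := u.antisymmetrization_eq hs.continuous hK hu hκ x y
    rw [hlin] at this
    simp only [LinearMap.id_apply, sub_self] at this
    linarith
  obtain ⟨h, hh, hhK⟩ := hK.exists_primitive hn hK0 hsymm hs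
  -- By `w3`, `κ` restricted to `L` measures the failure of `f₁` to be multiplicative, and `exp (2πi
  -- h)` fails in the same way. Their quotient is a character of `L`.
  have hφ : ∀ m m' : L, (u.f₁ (.ofAdd (m + m'), 1)).2 * (Circle.exp (2 * Real.pi * h ↑(m + m')))⁻¹ =
      ((u.f₁ (.ofAdd m, 1)).2 * (Circle.exp (2 * Real.pi * h m))⁻¹) *
        ((u.f₁ (.ofAdd m', 1)).2 * (Circle.exp (2 * Real.pi * h m'))⁻¹) := fun m m' => by
    have h3 := congrArg Prod.snd (u.w3 (.ofAdd m, 1) (.ofAdd m', 1))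
    rw [Theta_bd, Theta_bd, hκ] at h3
    simp only [Prod.snd_mul, Prod.mk_mul_mk, mul_one, ← ofAdd_add, toAdd_ofAdd] at h3
    rw [← h3, Submodule.coe_add, hhK, mul_add, mul_add, Circle.exp_add, Circle.exp_add, mul_inv,
      mul_inv]
    have : ∀ a b c d e : Circle, a * b * c * (d * e * c⁻¹) = a * d * (b * e) := by
      intro a b c d e
      rw [mul_mul_mul_comm a d b e, mul_mul_mul_comm (a * b) c (d * e) c⁻¹, mul_inv_cancel,
        mul_one]
    exact this _ _ _ _ _
  obtain ⟨l, hl⟩ := exists_linear_of_lattice_character L (φ := fun m =>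
    (u.f₁ (.ofAdd m, 1)).2 * (Circle.exp (2 * Real.pi * h m))⁻¹) hφ
  have h0 : h 0 = 0 := by
    have := hhK 0 0
    rw [add_zero, hK0] at this
    linarith
  have hlc : ContDiff ℝ n l := (LinearMap.toContinuousLinearMap l).contDiff
  -- The linear correction `l` adjusts `f₁` and leaves the coboundary of `h` unchanged.
  refine ⟨PointedMap.ofReal J n (hh.add hlc) (by simp [h0]), ?_⟩
  change PointedMap.toWeakEnd _ = u
  ext1
  · funext x
    rw [PointedMap.toWeakEnd_f₀, Theta_bd_of_fst (PointedMap.fst_eq_one _ _), mul_one]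
    exact (LinearMap.congr_fun hlin x.toAdd).symm
  · funext α
    refine Prod.ext ?_ ?_
    · rw [u.f₁_fst, hL]; exact mul_one _
    · have hf₁ : u.f₁ α = u.f₁ (α.1, 1) * (1, α.2) := by
        have h3 := u.w3 (α.1, 1) (1, α.2)
        rw [Theta_bd_of_fst (α := (1, α.2)) rfl, u.κ_one_right, mul_one, hu] at h3
        rw [h3]
        simp
      have h1 := hl α.1.toAdd
      rw [mul_inv_eq_iff_eq_mul] at h1
      rw [hf₁, Prod.snd_mul]
      change α.2 * Circle.exp (2 * Real.pi * (h _ + l _)) = _ * α.2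
      rw [mul_comm, mul_add, Circle.exp_add, mul_comm (Circle.exp _)]
      exact congrArg (· * α.2) h1.symm
  · funext x y
    refine Prod.ext ?_ ?_
    · rw [WeakEnd.κ_fst_eq_one, WeakEnd.κ_fst_eq_one]
    · rw [PointedMap.toWeakEnd_κ, Theta_act_of_fst (PointedMap.fst_eq_one _ _)]
      change (Circle.exp (2 * Real.pi * (h y.toAdd + l y.toAdd)))⁻¹ *
        (Circle.exp (2 * Real.pi * (h x.toAdd + l x.toAdd)))⁻¹ *
        Circle.exp (2 * Real.pi * (h (x.toAdd + y.toAdd) + l (x.toAdd + y.toAdd))) =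
        (u.κ (.ofAdd x.toAdd) (.ofAdd y.toAdd)).2
      rw [hκ, ← Circle.exp_neg, ← Circle.exp_neg, ← Circle.exp_add, ← Circle.exp_add, hhK, l.map_add]
      congr 1
      ring

end ThetaAnalysis

/-! ### Weak automorphisms and pointed maps built from integral forms. -/

section ThetaConstruction

variable {V : Type u} [NormedAddCommGroup V] [NormedSpace ℝ V] [FiniteDimensional ℝ V]
  (L : Submodule ℤ V) [DiscreteTopology L] [IsZLattice ℝ L]

/-- The `ℝ`-linear extension of an endomorphism of `L` to `V = L ⊗ ℝ`. -/
noncomputable def latticeExt (f : L →ₗ[ℤ] L) : V →ₗ[ℝ] V :=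
  ((Module.Free.chooseBasis ℤ L).ofZLatticeBasis ℝ L).constr ℝ
    fun i => (f (Module.Free.chooseBasis ℤ L i) : V)

theorem latticeExt_coe (f : L →ₗ[ℤ] L) (m : L) : latticeExt L f (m : V) = f m := by
  have h : ((latticeExt L f).toAddMonoidHom.comp L.subtype.toAddMonoidHom).toIntLinearMap =
      (L.subtype.toAddMonoidHom.comp f.toAddMonoidHom).toIntLinearMap :=
    (Module.Free.chooseBasis ℤ L).ext fun i => by
      change latticeExt L f (Module.Free.chooseBasis ℤ L i : V) = (f _ : V)
      rw [← Module.Basis.ofZLatticeBasis_apply ℝ L, latticeExt, Module.Basis.constr_basis]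
  exact LinearMap.congr_fun h m

theorem latticeExt_id : latticeExt L LinearMap.id = LinearMap.id :=
  linearMap_ext_lattice L fun m => latticeExt_coe L _ m

theorem latticeExt_comp (f g : L →ₗ[ℤ] L) :
    latticeExt L (f ∘ₗ g) = latticeExt L f ∘ₗ latticeExt L g :=
  linearMap_ext_lattice L fun m => by
    rw [LinearMap.comp_apply, latticeExt_coe, latticeExt_coe, latticeExt_coe]; rfl

theorem formExt_pullForm (B : LinearMap.BilinForm ℤ L) (f : L ≃ₗ[ℤ] L) (x y : V) :
    formExt L (pullForm B f) x y =
      formExt L B (latticeExt L f.toLinearMap x) (latticeExt L f.toLinearMap y) := by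
  have h : formExt L (pullForm B f) = (formExt L B).compl₁₂ (latticeExt L f.toLinearMap)
      (latticeExt L f.toLinearMap) := bilin_ext_lattice L fun m m' => by
    rw [LinearMap.compl₁₂_apply, latticeExt_coe, latticeExt_coe, formExt_coe, formExt_coe]; rfl
  rw [h]; rfl

theorem formExt_add (B C : LinearMap.BilinForm ℤ L) :
    formExt L (B + C) = formExt L B + formExt L C :=
  bilin_ext_lattice L fun m m' => by
    simp [formExt_coe]

theorem formExt_zero : formExt L 0 = 0 :=
  bilin_ext_lattice L fun m m' => by
    simp [formExt_coe]

theorem dualExt_add (l l' : Module.Dual ℤ L) : dualExt L (l + l') = dualExt L l + dualExt L l' :=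
  linearMap_ext_lattice L fun m => by
    simp [dualExt_coe]

theorem dualExt_comp (l : Module.Dual ℤ L) (f : L →ₗ[ℤ] L) (x : V) :
    dualExt L (l ∘ₗ f) x = dualExt L l (latticeExt L f x) := by
  have h : dualExt L (l ∘ₗ f) = dualExt L l ∘ₗ latticeExt L f := linearMap_ext_lattice L fun m => by
    rw [LinearMap.comp_apply, latticeExt_coe, dualExt_coe, dualExt_coe]; rfl
  rw [h]; rfl

theorem OTilde.formExt_cond {J : LinearMap.BilinForm ℤ L} (a : OTilde J) (x y : V) :
    formExt L a.B x y - formExt L a.B y x = formExt L J x y -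
      formExt L J (latticeExt L a.f.1.toLinearMap x) (latticeExt L a.f.1.toLinearMap y) := by
  have h : formExt L a.B - (formExt L a.B).flip = formExt L J -
      formExt L (pullForm J a.f.1) := bilin_ext_lattice L fun m m' => by
    simp only [LinearMap.sub_apply, LinearMap.flip_apply, formExt_coe, pullForm_apply]
    exact_mod_cast a.cond_apply m m'
  rw [← formExt_pullForm]
  exact LinearMap.congr_fun₂ h x y

theorem contDiff_formExt (n : WithTop ℕ∞) (B : LinearMap.BilinForm ℤ L) :
    ContDiff ℝ n fun p : V × V => formExt L B p.1 p.2 :=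
  (LinearMap.toContinuousLinearMap
    ((LinearMap.toContinuousLinearMap : (V →ₗ[ℝ] ℝ) ≃ₗ[ℝ] _).toLinearMap ∘ₗ
      formExt L B)).isBoundedBilinearMap.contDiff

theorem circleExp_formExt_coe (B : LinearMap.BilinForm ℤ L) (m m' : L) :
    Circle.exp (2 * Real.pi * formExt L B m m') = 1 := by
  rw [formExt_coe, mul_comm, Circle.exp_int_mul_two_pi]

variable {L} {J : LinearMap.BilinForm ℤ L}

theorem Theta_act {n : WithTop ℕ∞} (α : Multiplicative L × Circle) (x : Multiplicative V) :
    (Theta L n J).act α x =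
      (α.1, α.2 * Circle.exp (2 * Real.pi * formExt L J (α.1.toAdd : V) x.toAdd)) := rfl

/-- The weak endomorphism of `Θ` with `κ = exp (2 π i B)` belonging to `(f, B)`. -/
noncomputable def OTilde.weakEnd (n : WithTop ℕ∞) (a : OTilde J) : WeakEnd (Theta L n J) where
  f₀ x := .ofAdd (latticeExt L a.f.1.toLinearMap x.toAdd)
  f₁ α := (.ofAdd (a.f.1 α.1.toAdd), α.2)
  κ x y := (1, Circle.exp (2 * Real.pi * formExt L a.B x.toAdd y.toAdd))
  contMDiff_f₀ := (LinearMap.toContinuousLinearMap (latticeExt L a.f.1.toLinearMap)).contMDiff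
  contMDiff_f₁ := by
    have h : ContMDiff 𝓘(ℝ, PUnit.{1}) 𝓘(ℝ, PUnit.{1}) n
        (fun m : Multiplicative L => (Multiplicative.ofAdd (a.f.1 m.toAdd))) :=
      have : DiscreteTopology (Multiplicative L) := inferInstanceAs (DiscreteTopology L)
      contMDiff_of_discreteTopology
    exact (h.comp contMDiff_fst).prodMk contMDiff_snd
  contMDiff_κ := by
    have h0 : ContMDiff 𝓘(ℝ, V) 𝓘(ℝ, V) n (fun x : Multiplicative V => x.toAdd) := contMDiff_id
    have h1 : ContDiff ℝ n fun p : V × V => 2 * Real.pi * formExt L a.B p.1 p.2 :=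
      contDiff_const.mul (contDiff_formExt L n a.B)
    have h2 := h1.contMDiff.comp
      ((h0.comp contMDiff_fst).prodMk_space (h0.comp contMDiff_snd) :
        ContMDiff (𝓘(ℝ, V).prod 𝓘(ℝ, V)) 𝓘(ℝ, V × V) n
          fun p : Multiplicative V × Multiplicative V => (p.1.toAdd, p.2.toAdd))
    exact contMDiff_const.prodMk (contMDiff_circleExp.comp h2)
  f₀_one := congrArg Multiplicative.ofAdd (map_zero _)
  f₁_one := Prod.ext (congrArg Multiplicative.ofAdd (map_zero _)) rfl
  w1 α := congrArg Multiplicative.ofAdd (latticeExt_coe L _ _)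
  w2 x y := by
    rw [Theta_bd_of_fst rfl, mul_one, toAdd_mul, map_add]; rfl
  w3 α β := by
    refine Prod.ext ?_ ?_
    · change Multiplicative.ofAdd _ * Multiplicative.ofAdd _ * 1 = Multiplicative.ofAdd _
      rw [mul_one, ← ofAdd_add, ← map_add]; rfl
    -- Integrality of `B` makes `κ` trivial on the lattice, so `f₁` may be a genuine homomorphism.
    · change α.2 * β.2 * Circle.exp (2 * Real.pi *
        formExt L a.B (α.1.toAdd : V) (β.1.toAdd : V)) = α.2 * β.2
      rw [circleExp_formExt_coe, mul_one]
  w4 x y z := by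
    rw [Theta_act_of_fst rfl]
    simp only [Prod.mk_mul_mk, mul_one]
    refine congrArg (Prod.mk 1) ?_
    rw [← Circle.exp_add, ← Circle.exp_add]
    refine congrArg Circle.exp ?_
    simp only [toAdd_mul, map_add, LinearMap.add_apply]
    ring
  w5 α x := by
    -- The condition `B - Bᵗ = J - f^*J`, extended to `V`, is exactly what equivariance requires.
    have h := a.formExt_cond L (α.1.toAdd : V) x.toAdd
    rw [latticeExt_coe] at h
    have h' : formExt L J (a.f.1 α.1.toAdd : L) (latticeExt L a.f.1.toLinearMap x.toAdd) +
        formExt L a.B (α.1.toAdd : V) x.toAdd =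
        formExt L J (α.1.toAdd : V) x.toAdd + formExt L a.B x.toAdd (α.1.toAdd : V) := by
      change formExt L J (a.f.1.toLinearMap α.1.toAdd : L) (latticeExt L _ _) + _ = _
      linarith
    simp only [Theta_act, Theta_bd, Prod.mk_mul_mk, mul_one, toAdd_ofAdd]
    refine congrArg (Prod.mk _) ?_
    rw [mul_assoc α.2, mul_assoc α.2, ← Circle.exp_add, ← Circle.exp_add, ← mul_add, ← mul_add, h']

theorem OTilde.weakEnd_f₁ (n : WithTop ℕ∞) (a : OTilde J) (α : Multiplicative L × Circle) :
    (a.weakEnd n).f₁ α = (.ofAdd (a.f.1 α.1.toAdd), α.2) := rfl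
theorem OTilde.weakEnd_κ (n : WithTop ℕ∞) (a : OTilde J) (x y : Multiplicative V) :
    (a.weakEnd n).κ x y = (1, Circle.exp (2 * Real.pi * formExt L a.B x.toAdd y.toAdd)) := rfl
theorem OTilde.weakEnd_arr_of_fst (n : WithTop ℕ∞) (a : OTilde J) (x : Multiplicative V)
    {α : Multiplicative L × Circle} (h : α.1 = 1) : (a.weakEnd n).arr x α = α := by
  rw [WeakEnd.arr, Theta_bd_of_fst h, WeakEnd.κ_one_right, mul_one, weakEnd_f₁, h, toAdd_one,
    map_zero]
  exact Prod.ext h.symm rfl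

/-- The weak endomorphisms `OTilde.weakEnd` form a homomorphism. -/
noncomputable def OTilde.weakEndHom (n : WithTop ℕ∞) (J : LinearMap.BilinForm ℤ L) :
    OTilde J →* WeakEnd (Theta L n J) where
  toFun := weakEnd n
  map_one' := by
    ext1
    · funext x
      exact congrArg Multiplicative.ofAdd (LinearMap.congr_fun (latticeExt_id L) x.toAdd)
    · rfl
    · funext x y
      rw [weakEnd_κ, one_B, formExt_zero]
      simp; rfl
  map_mul' a b := by
    have hf : latticeExt L (a * b).f.1.toLinearMap =
        latticeExt L a.f.1.toLinearMap ∘ₗ latticeExt L b.f.1.toLinearMap :=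
      latticeExt_comp L a.f.1.toLinearMap b.f.1.toLinearMap
    ext1
    · funext x
      exact congrArg Multiplicative.ofAdd (LinearMap.congr_fun hf x.toAdd)
    · rfl
    · funext x y
      rw [WeakEnd.mul_κ, weakEnd_arr_of_fst n _ _ (WeakEnd.κ_fst_eq_one _ _ _), weakEnd_κ, weakEnd_κ,
        weakEnd_κ, mul_B, formExt_add, LinearMap.add_apply, LinearMap.add_apply, mul_add,
        Circle.exp_add, formExt_pullForm]
      exact Prod.ext (mul_one _).symm rfl

theorem Theta_bd_eq_one_iff {n : WithTop ℕ∞} (α : Multiplicative L × Circle) :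
    (Theta L n J).bd α = 1 ↔ α.1 = 1 := by
  refine ⟨fun h => ?_, Theta_bd_of_fst⟩
  exact Multiplicative.toAdd.injective (Subtype.ext (congrArg Multiplicative.toAdd h))

variable (L) in
/-- The function `x ↦ (B(x, x) + l(x)) / 2` on `V`. -/
noncomputable def halfForm (p : LinearMap.BilinForm ℤ L × Module.Dual ℤ L) (x : V) : ℝ :=
  (formExt L p.1 x x + dualExt L p.2 x) / 2

theorem contDiff_halfForm (n : WithTop ℕ∞) (p : LinearMap.BilinForm ℤ L × Module.Dual ℤ L) :
    ContDiff ℝ n (halfForm L p) :=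
  (((contDiff_formExt L n p.1).comp (contDiff_id.prodMk contDiff_id)).add
    (LinearMap.toContinuousLinearMap (dualExt L p.2)).contDiff).div_const 2

theorem halfForm_apply_zero (p : LinearMap.BilinForm ℤ L × Module.Dual ℤ L) :
    halfForm L p 0 = 0 := by
  simp [halfForm]

theorem halfForm_add (p q : LinearMap.BilinForm ℤ L × Module.Dual ℤ L) (x : V) :
    halfForm L (p + q) x = halfForm L p x + halfForm L q x := by
  simp only [halfForm, Prod.fst_add, Prod.snd_add, formExt_add, dualExt_add, LinearMap.add_apply]
  ring

/-- The homomorphism from pairs `(B, l)` to pointed maps, sending `(B, l)` to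
`x ↦ (0, exp (π i (B(x, x) + l(x))))`. -/
noncomputable def parityPairs.pointedMapHom (n : WithTop ℕ∞) (J : LinearMap.BilinForm ℤ L) :
    Multiplicative (parityPairs L) →* PointedMap (Theta L n J) where
  toFun p := PointedMap.ofReal J n (contDiff_halfForm n p.toAdd.1) (halfForm_apply_zero _)
  map_one' := by
    ext1; funext x
    have h : halfForm L (0 : LinearMap.BilinForm ℤ L × Module.Dual ℤ L) x.toAdd = 0 := by
      have := halfForm_add (0 : LinearMap.BilinForm ℤ L × Module.Dual ℤ L) 0 x.toAdd
      rw [add_zero] at this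
      linarith
    exact (congrArg (fun t => ((1 : Multiplicative L), Circle.exp (2 * Real.pi * t))) h).trans
      (by rw [mul_zero, Circle.exp_zero]; rfl)
  map_mul' p q := by
    ext1; funext x
    rw [PointedMap.theta_mul_apply, PointedMap.ofReal_apply, PointedMap.ofReal_apply,
      PointedMap.ofReal_apply, Prod.mk_mul_mk, mul_one, ← Circle.exp_add, ← mul_add, toAdd_mul,
      AddSubgroup.coe_add, halfForm_add, add_comm]

theorem parityPairs.pointedMapHom_apply (n : WithTop ℕ∞) (J : LinearMap.BilinForm ℤ L)
    (p : Multiplicative (parityPairs L)) (x : Multiplicative V) :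
    pointedMapHom n J p x = (1, Circle.exp (2 * Real.pi * halfForm L p.toAdd.1 x.toAdd)) := rfl

end ThetaConstruction

/-! ### Comparison of `XiCover` with the weak automorphisms of `Θ`. -/

section ThetaEquivalence

theorem exists_int_of_circleExp_eq_one {t : ℝ} (h : Circle.exp (2 * Real.pi * t) = 1) :
    ∃ k : ℤ, t = k := by
  obtain ⟨k, hk⟩ := Circle.exp_eq_one.mp h
  exact ⟨k, mul_left_cancel₀ Real.two_pi_pos.ne' (hk.trans (mul_comm _ _))⟩

variable {V : Type u} [NormedAddCommGroup V] [NormedSpace ℝ V] [FiniteDimensional ℝ V]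
  {L : Submodule ℤ V} [DiscreteTopology L] [IsZLattice ℝ L] {J : LinearMap.BilinForm ℤ L}
  {n : WithTop ℕ∞}

theorem mem_centrePreserving_iff {u : (WeakEnd (Theta L n J))ˣ} :
    u ∈ centrePreserving (Theta L n J) ↔ ∀ z : Circle, u.1.f₁ (1, z) = (1, z) := by
  refine ⟨fun h z => h _ (Theta_bd_of_fst rfl), fun h α hα => ?_⟩
  rw [Theta_bd_eq_one_iff] at hα
  rw [show α = (1, α.2) from Prod.ext hα rfl]
  exact h _

/-- Polarization: half the quadratic form of a symmetric `B` has coboundary `B`, and the linear part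
contributes nothing. -/
theorem halfForm_add_apply {p : LinearMap.BilinForm ℤ L × Module.Dual ℤ L}
    (hp : ∀ m m', p.1 m m' = p.1 m' m) (x y : V) :
    halfForm L p (x + y) = halfForm L p x + halfForm L p y + formExt L p.1 x y := by
  have h : (formExt L p.1).flip = formExt L p.1 := bilin_ext_lattice L fun m m' => by
    rw [LinearMap.flip_apply, formExt_coe, formExt_coe, hp]
  have h' : formExt L p.1 y x = formExt L p.1 x y := LinearMap.congr_fun₂ h x y
  simp only [halfForm, map_add, LinearMap.add_apply, h']
  ring

/-- This is the purpose of the parity condition: `halfForm` takes integral values on `L`. -/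
theorem circleExp_halfForm_coe (p : parityPairs L) (m : L) :
    Circle.exp (2 * Real.pi * halfForm L p.1 m) = 1 := by
  obtain ⟨k, hk⟩ := p.2.2 m
  have : halfForm L p.1 m = k := by
    rw [halfForm, formExt_coe, dualExt_coe, ← Int.cast_add, hk]
    push_cast
    ring
  rw [this, mul_comm, Circle.exp_int_mul_two_pi]

/-- The coboundary of `halfForm` is `B`, which accounts for `κ`; its integrality on `L` keeps `f₁`
the identity. -/
theorem delta_pointedMapHom (p : Multiplicative (parityPairs L)) :
    PointedMap.delta (parityPairs.pointedMapHom n J p) = ((XiCover J).bd p).weakEnd n := by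
  change PointedMap.toWeakEnd _ = _
  ext1
  · funext x
    rw [PointedMap.toWeakEnd_f₀, Theta_bd_of_fst (PointedMap.fst_eq_one _ _), mul_one]
    exact (congrArg Multiplicative.ofAdd (LinearMap.congr_fun (latticeExt_id L) x.toAdd)).symm
  · funext α
    rw [PointedMap.toWeakEnd_f₁, parityPairs.pointedMapHom_apply]
    have h : halfForm L p.toAdd.1 ((Theta L n J).bd α).toAdd = halfForm L p.toAdd.1 α.1.toAdd := rfl
    rw [h, circleExp_halfForm_coe]
    exact mul_one α
  · funext x y
    rw [PointedMap.toWeakEnd_κ, Theta_act_of_fst (PointedMap.fst_eq_one _ _),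
      parityPairs.pointedMapHom_apply, parityPairs.pointedMapHom_apply,
      parityPairs.pointedMapHom_apply, toAdd_mul, halfForm_add_apply p.toAdd.2.1,
      OTilde.weakEnd_κ, Prod.inv_mk, Prod.inv_mk, Prod.mk_mul_mk, Prod.mk_mul_mk, inv_one, mul_one,
      mul_one, ← Circle.exp_neg, ← Circle.exp_neg, ← Circle.exp_add, ← Circle.exp_add]
    refine congrArg (fun t => ((1 : Multiplicative L), Circle.exp t)) ?_
    change _ = 2 * Real.pi * formExt L p.toAdd.1.1 x.toAdd y.toAdd
    ring

variable (L n J) in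
/-- The crossed module covering `Ξ` maps to the centre-preserving weak automorphisms of `Θ`. -/
noncomputable def XiCover.toWActPlus :
    CrossedModule.Morphism (XiCover J) (wActPlus (Theta L n J)) where
  hom₀ := (OTilde.weakEndHom n J).toHomUnits.codRestrict _ fun a =>
    mem_centrePreserving_iff.mpr fun z => by
      rw [MonoidHom.coe_toHomUnits]
      exact Prod.ext (congrArg Multiplicative.ofAdd (map_zero a.f.1)) rfl
  hom₁ := (parityPairs.pointedMapHom n J).toHomUnits
  bd_hom₁ p := Subtype.ext (Units.ext (delta_pointedMapHom p))
  hom₁_act p a := by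
    refine Units.ext (PointedMap.ext (funext fun x => ?_))
    change parityPairs.pointedMapHom n J ((XiCover J).act p a) x =
      PointedMap.conj (parityPairs.pointedMapHom n J p) ((OTilde.weakEndHom n J).toHomUnits a) x
    rw [PointedMap.conj_apply, ← map_inv, MonoidHom.coe_toHomUnits, MonoidHom.coe_toHomUnits]
    change _ = (OTilde.weakEnd n a⁻¹).arr _ _
    -- The inverse automorphism fixes `U(1)`, so conjugation reduces to precomposition with `f`.
    rw [OTilde.weakEnd_arr_of_fst n _ _ (PointedMap.fst_eq_one _ _),
      parityPairs.pointedMapHom_apply, parityPairs.pointedMapHom_apply]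
    refine congrArg (fun t => ((1 : Multiplicative L), Circle.exp (2 * Real.pi * t))) ?_
    change (formExt L (pullForm p.toAdd.1.1 a.f.1) x.toAdd x.toAdd +
      dualExt L (p.toAdd.1.2 ∘ₗ a.f.1.toLinearMap) x.toAdd) / 2 = _
    rw [formExt_pullForm, dualExt_comp]
    rfl

/-- Equal phases have equal lifts `halfForm`; once the forms `B` agree, the linear parts must agree
too. -/
theorem XiCover.toWActPlus_hom₁_injective {p q : Multiplicative (parityPairs L)}
    (hB : (XiCover J).bd p = (XiCover J).bd q)
    (h : (toWActPlus L J n).hom₁ p = (toWActPlus L J n).hom₁ q) : p = q := by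
  have hB' : p.toAdd.1.1 = q.toAdd.1.1 := congrArg OTilde.B hB
  have h1 : ∀ x : V, parityPairs.pointedMapHom n J p (.ofAdd x) =
      parityPairs.pointedMapHom n J q (.ofAdd x) := fun x =>
    congrFun (congrArg (fun η => PointedMap.toFun (Units.val η)) h) _
  have h2 := eq_of_circleExp_eq (contDiff_halfForm 0 p.toAdd.1).continuous
    (contDiff_halfForm 0 q.toAdd.1).continuous (fun x => congrArg Prod.snd (h1 x)) 0
    (by rw [halfForm_apply_zero, halfForm_apply_zero])
  refine Multiplicative.toAdd.injective (Subtype.ext (Prod.ext hB' (LinearMap.ext fun m => ?_)))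
  have h3 := congrFun h2 m
  simp only [halfForm, hB', dualExt_coe] at h3
  have h4 : (p.toAdd.1.2 m : ℝ) = q.toAdd.1.2 m := by linarith
  exact_mod_cast h4

theorem PointedMap.exists_lift (η : PointedMap (Theta L n J)) :
    ∃ h : V → ℝ, ContDiff ℝ n h ∧ h 0 = 0 ∧
      ∀ x : V, η (.ofAdd x) = (1, Circle.exp (2 * Real.pi * h x)) := by
  have h1 : ContMDiff 𝓘(ℝ, V) (𝓡 1) n fun x : V => (η (.ofAdd x)).2 :=
    contMDiff_snd.comp η.contMDiff
  obtain ⟨h, hh, h0, hη⟩ := h1.exists_circle_lift (by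
    change (η 1).2 = 1
    rw [η.map_one]; rfl)
  exact ⟨h, hh, h0, fun x => Prod.ext (η.fst_eq_one _) (hη x)⟩

/-- A pointed map whose boundary belongs to `(f, B)` belongs to a pair `(B, l)`. -/
theorem exists_parityPair_of_delta_eq {a : OTilde J} {η : PointedMap (Theta L n J)}
    (h : a.weakEnd n = PointedMap.delta η) :
    ∃ p, (XiCover J).bd p = a ∧ parityPairs.pointedMapHom n J p = η := by
  replace h : a.weakEnd n = η.toWeakEnd := h
  obtain ⟨g, hg, hg0, hη⟩ := η.exists_lift
  have hgc := hg.continuous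
  have hf : a.f = 1 := Subtype.ext (LinearEquiv.ext fun m => Subtype.ext (by
    have h1 := congrFun (congrArg WeakEnd.f₀ h) (.ofAdd (m : V))
    rw [PointedMap.toWeakEnd_f₀, Theta_bd_of_fst (PointedMap.fst_eq_one _ _), mul_one] at h1
    have h2 : latticeExt L a.f.1.toLinearMap (m : V) = m := congrArg Multiplicative.toAdd h1
    rw [latticeExt_coe] at h2
    exact h2))
  have hBc := (contDiff_formExt L 0 a.B).continuous
  have hadd : ∀ x y, g (x + y) = g x + g y + formExt L a.B x y := fun x y => by
    refine congrFun (eq_of_circleExp_eq (W := V × V) (f := fun p => g (p.1 + p.2))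
      (g := fun p => g p.1 + g p.2 + formExt L a.B p.1 p.2) (by fun_prop) (by fun_prop)
      (fun p => ?_) (0, 0) (by simp [hg0])) (x, y)
    have h1 := congrFun₂ (congrArg WeakEnd.κ h) (.ofAdd p.1) (.ofAdd p.2)
    rw [PointedMap.toWeakEnd_κ, Theta_act_of_fst (PointedMap.fst_eq_one _ _), ← ofAdd_add, hη, hη,
      hη] at h1
    have h2 : Circle.exp (2 * Real.pi * formExt L a.B p.1 p.2) =
      (Circle.exp (2 * Real.pi * g p.2))⁻¹ * (Circle.exp (2 * Real.pi * g p.1))⁻¹ *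
        Circle.exp (2 * Real.pi * g (p.1 + p.2)) := congrArg Prod.snd h1
    rw [mul_add, mul_add, Circle.exp_add, Circle.exp_add, h2,
      ← mul_inv_rev, mul_inv_cancel_left]
  have hsymm : ∀ x y : V, formExt L a.B x y = formExt L a.B y x := fun x y => by
    have h1 := hadd x y
    have h2 := hadd y x
    rw [add_comm y x] at h2
    linarith
  -- The lift `g` has coboundary `B`, as does `B(x, x) / 2`. Twice their difference is additive and
  -- continuous, so it is the linear form wanted.
  let l : V →ₗ[ℝ] ℝ := (AddMonoidHom.toRealLinearMap
    (AddMonoidHom.mk' (fun x : V => 2 * g x - formExt L a.B x x) fun x y => by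
      simp only [hadd, map_add, LinearMap.add_apply, hsymm y x]
      ring) (by
      have h1 := hBc.comp (continuous_id.prodMk continuous_id)
      exact (continuous_const.mul hgc).sub h1)).toLinearMap
  have hl : ∀ x, l x = 2 * g x - formExt L a.B x x := fun x => rfl
  -- The `f₁` of `(f, B)` does not change the circle component, so `g` is integral on `L`. Then
  -- `l(m) = 2 g(m) - B(m, m)` is an integer of the required parity.
  have hint : ∀ m : L, ∃ k : ℤ, g m = k := fun m => by
    have h1 := congrFun (congrArg WeakEnd.f₁ h) (.ofAdd m, 1)
    rw [PointedMap.toWeakEnd_f₁, Theta_bd, hη] at h1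
    have h2 : 1 = 1 * Circle.exp (2 * Real.pi * g m) := congrArg Prod.snd h1
    rw [one_mul] at h2
    exact exists_int_of_circleExp_eq_one h2.symm
  obtain ⟨l', hl'⟩ := exists_dualExt_eq L (l := l) fun m => by
    obtain ⟨k, hk⟩ := hint m
    exact ⟨2 * k - a.B m m, by rw [hl, hk, formExt_coe]; push_cast; rfl⟩
  refine ⟨.ofAdd ⟨(a.B, l'), fun m m' => ?_, fun m => ?_⟩, OTilde.ext hf.symm rfl, ?_⟩
  · have h1 := hsymm m m'
    rw [formExt_coe, formExt_coe] at h1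
    exact_mod_cast h1
  · obtain ⟨k, hk⟩ := hint m
    refine ⟨k, ?_⟩
    have h1 := hl m
    rw [← hl', dualExt_coe, hk, formExt_coe] at h1
    have h2 : ((a.B m m + l' m : ℤ) : ℝ) = (k + k : ℤ) := by
      push_cast
      linarith
    exact_mod_cast h2
  · ext1; funext x
    refine (parityPairs.pointedMapHom_apply _ _ _ _).trans (Eq.trans ?_ (hη x.toAdd).symm)
    refine congrArg (fun t => ((1 : Multiplicative L), Circle.exp (2 * Real.pi * t))) ?_
    change (formExt L a.B x.toAdd x.toAdd + dualExt L l' x.toAdd) / 2 = _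
    rw [hl', hl]
    ring

end ThetaEquivalence

/-! ### The isometry homomorphism, the equivalence, `π₀` and `π₁`. -/

section ThetaMain

variable {V : Type u} [NormedAddCommGroup V] [NormedSpace ℝ V] [FiniteDimensional ℝ V]
  {L : Submodule ℤ V} [DiscreteTopology L] [IsZLattice ℝ L] {J : LinearMap.BilinForm ℤ L}
  {n : WithTop ℕ∞}

variable (L J n) in
/-- The isometry of `L` underlying a centre-preserving weak automorphism of `Θ`. -/
noncomputable def isometryHom :
    centrePreserving (Theta L n J) →* isometryGroup (J + J.flip) :=
  (((LinearMap.GeneralLinearGroup.generalLinearEquiv ℤ L).toMonoidHom.comp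
    (Units.map (WeakEnd.latticeHom L J n))).comp (centrePreserving (Theta L n J)).subtype).codRestrict
      _ fun u => u.1.1.latticeEnd_isometry (mem_centrePreserving_iff.mp u.2)

theorem isometryHom_apply (u : centrePreserving (Theta L n J)) (m : L) :
    (isometryHom L J n u).1 m = u.1.1.latticeEnd m := rfl

theorem f₀_coe_eq_isometryHom (u : centrePreserving (Theta L n J)) (m : L) :
    u.1.1.f₀ (.ofAdd (m : V)) = .ofAdd (((isometryHom L J n u).1 m : L) : V) :=
  congrArg Multiplicative.ofAdd (u.1.1.linear_coe m)

theorem isometryHom_bd (η : (PointedMap (Theta L n J))ˣ) :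
    isometryHom L J n ((wActPlus (Theta L n J)).bd η) = 1 :=
  Subtype.ext (LinearEquiv.ext fun m => by
    rw [isometryHom_apply, WeakEnd.latticeEnd_apply]
    change (Multiplicative.ofAdd m * (η.1 _).1).toAdd = m
    rw [PointedMap.fst_eq_one, mul_one, toAdd_ofAdd])

/-- Together with `isometryHom_bd` this identifies the kernel of `isometryHom` with the image of the
boundary. -/
theorem exists_bd_eq (hn : ∞ ≤ n) {u : centrePreserving (Theta L n J)}
    (hu : isometryHom L J n u = 1) : ∃ η, (wActPlus (Theta L n J)).bd η = u := by
  obtain ⟨η, hη⟩ := u.1.1.exists_delta_eq hn (mem_centrePreserving_iff.mp u.2) fun m => by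
    rw [← isometryHom_apply, hu]; rfl
  obtain ⟨η', rfl⟩ := η.theta_isUnit
  exact ⟨η', Subtype.ext (Units.ext hη)⟩

theorem isometryHom_weakEnd (a : OTilde J) :
    isometryHom L J n ((XiCover.toWActPlus L J n).hom₀ a) = a.f := rfl

theorem isometryHom_surjective : Function.Surjective (isometryHom L J n) := fun f => by
  obtain ⟨a, rfl⟩ := OTilde.exists_of_isometry J f
  exact ⟨_, isometryHom_weakEnd a⟩

theorem XiCover.exists_of_hom₀_eq_bd {a : OTilde J} {η : (PointedMap (Theta L n J))ˣ}
    (h : (toWActPlus L J n).hom₀ a = (wActPlus (Theta L n J)).bd η) :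
    ∃ p, (XiCover J).bd p = a ∧ (toWActPlus L J n).hom₁ p = η := by
  obtain ⟨p, hp, hη⟩ := exists_parityPair_of_delta_eq (a := a) (η := η.1)
    (congrArg (fun u => u.1.1) h)
  exact ⟨p, hp, Units.ext hη⟩

theorem XiCover.toWActPlus_isEquivalence (hn : ∞ ≤ n) :
    (toWActPlus L J n).functor.IsEquivalence := by
  refine CrossedModule.Morphism.isEquivalence _ (fun p q => toWActPlus_hom₁_injective)
    (fun a η => exists_of_hom₀_eq_bd) (fun u => ?_)
  obtain ⟨a, ha⟩ := OTilde.exists_of_isometry J (isometryHom L J n u)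
  -- An element `a` with the same isometry as `u` differs from it by something trivial on the
  -- lattice, hence by a boundary.
  obtain ⟨η, hη⟩ := exists_bd_eq hn (u := ((toWActPlus L J n).hom₀ a)⁻¹ * u) (by
    rw [map_mul, map_inv, isometryHom_weakEnd, ha, inv_mul_cancel])
  exact ⟨a, η, by rw [hη, mul_inv_cancel_left]⟩

/-! ### The group of isomorphism classes -/

theorem isometryHom_eq_iff (hn : ∞ ≤ n) (u v : (wActPlus (Theta L n J)).CatGroup) :
    isometryHom L J n u.of = isometryHom L J n v.of ↔ Nonempty (u ≅ v) := by
  refine ⟨fun h => ?_, fun ⟨i⟩ => ?_⟩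
  · obtain ⟨η, hη⟩ := exists_bd_eq hn (u := u.of⁻¹ * v.of) (by
      rw [map_mul, map_inv, h, inv_mul_cancel])
    exact ⟨(Groupoid.isoEquivHom _ _).symm
      (CrossedModule.CatGroup.homMk η (by rw [hη, mul_inv_cancel_left]))⟩
  · rw [← CrossedModule.CatGroup.of_mul_bd_label i.hom, map_mul, isometryHom_bd, mul_one]

theorem exists_skeleton_mulEquiv (hn : ∞ ≤ n) :
    ∃ e : Skeleton (wActPlus (Theta L n J)).CatGroup ≃* isometryGroup (J + J.flip),
      ∀ u, e (toSkeleton u) = isometryHom L J n u.of := by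
  let g : Skeleton (wActPlus (Theta L n J)).CatGroup → isometryGroup (J + J.flip) :=
    Quotient.lift (fun u => isometryHom L J n u.of) fun u v h => (isometryHom_eq_iff hn u v).mpr h
  have hg : ∀ u, g (toSkeleton u) = isometryHom L J n u.of := fun u => rfl
  have hmul : ∀ X Y, g (X * Y) = g X * g Y := fun X Y => by
    induction X using Quotient.inductionOn with
    | h u =>
    induction Y using Quotient.inductionOn with
    | h v =>
    change g (toSkeleton u * toSkeleton v) = g (toSkeleton u) * g (toSkeleton v)
    rw [← Skeleton.toSkeleton_tensorObj, hg, hg, hg, CrossedModule.CatGroup.of_tensorObj, map_mul]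
  refine ⟨MulEquiv.ofBijective (MulHom.mk g hmul) ⟨fun X Y h => ?_, fun f => ?_⟩, hg⟩
  · induction X using Quotient.inductionOn with
    | h u =>
    induction Y using Quotient.inductionOn with
    | h v => exact Quotient.sound ((isometryHom_eq_iff hn u v).mp h)
  · obtain ⟨u, hu⟩ := isometryHom_surjective (L := L) (J := J) (n := n) f
    exact ⟨toSkeleton ⟨u⟩, hu⟩

/-! ### Characters of the torus -/

variable (L) in
/-- The character `[x] ↦ exp (2 π i l(x))` of the torus. -/
noncomputable def torusCharacter (l : Module.Dual ℤ L) : CharTorus L where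
  toFun t := QuotientAddGroup.lift L.toAddSubgroup
    (AddMonoidHom.mk' (fun x => Additive.ofMul (Circle.exp (2 * Real.pi * dualExt L l x)))
      fun x y => by rw [map_add, mul_add, Circle.exp_add]; rfl)
    (fun x hx => by
      change Additive.ofMul (Circle.exp (2 * Real.pi * dualExt L l ((⟨x, hx⟩ : L) : V))) = 0
      rw [dualExt_coe, mul_comm, Circle.exp_int_mul_two_pi]; rfl) t.toAdd |>.toMul
  map_one' := congrArg Additive.toMul (map_zero _)
  map_mul' s t := congrArg Additive.toMul (map_add _ s.toAdd t.toAdd)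
  continuous_toFun := by
    refine continuous_coinduced_dom.mpr ?_
    exact Circle.exp.continuous.comp
      (continuous_const.mul (LinearMap.continuous_of_finiteDimensional (dualExt L l)))

theorem torusCharacter_mk (l : Module.Dual ℤ L) (x : V) :
    torusCharacter L l (.ofAdd (QuotientAddGroup.mk x)) =
      Circle.exp (2 * Real.pi * dualExt L l x) := rfl

theorem CharTorus.ext_mk {V : Type*} [NormedAddCommGroup V] {L : Submodule ℤ V} {χ χ' : CharTorus L}
    (h : ∀ x : V, χ (.ofAdd (QuotientAddGroup.mk x)) = χ' (.ofAdd (QuotientAddGroup.mk x))) :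
    χ = χ' :=
  ContinuousMonoidHom.ext fun t => by
    obtain ⟨x, hx⟩ := QuotientAddGroup.mk_surjective t.toAdd
    have := h x
    rw [hx] at this
    exact this

theorem dualExt_injective {l l' : Module.Dual ℤ L} (h : dualExt L l = dualExt L l') : l = l' :=
  LinearMap.ext fun m => by
    have := LinearMap.congr_fun h m
    rw [dualExt_coe, dualExt_coe] at this
    exact_mod_cast this

/-- Pulled back to `V`, a character of the torus is the exponential of a linear form; triviality on
`L` makes that form integral there. -/
theorem exists_dual_mulEquiv : ∃ e : Multiplicative (Module.Dual ℤ L) ≃* CharTorus L,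
    ∀ (l : Module.Dual ℤ L) (x : V), e (.ofAdd l) (.ofAdd (QuotientAddGroup.mk x)) =
      Circle.exp (2 * Real.pi * dualExt L l x) := by
  let g : Multiplicative (Module.Dual ℤ L) →* CharTorus L :=
    MonoidHom.mk' (fun l => torusCharacter L l.toAdd) fun l l' => CharTorus.ext_mk fun x => by
      rw [ContinuousMonoidHom.mul_apply, torusCharacter_mk, torusCharacter_mk, torusCharacter_mk,
        toAdd_mul, dualExt_add, LinearMap.add_apply, mul_add, Circle.exp_add]
  refine ⟨MulEquiv.ofBijective g ⟨fun l l' h => ?_, fun χ => ?_⟩, fun l x => torusCharacter_mk l x⟩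
  · refine Multiplicative.toAdd.injective (dualExt_injective (LinearMap.ext fun x => congrFun
      (eq_of_circleExp_eq (LinearMap.continuous_of_finiteDimensional (dualExt L l.toAdd))
        (LinearMap.continuous_of_finiteDimensional (dualExt L l'.toAdd)) (fun x => ?_) 0
        (by simp)) x))
    exact DFunLike.congr_fun h (.ofAdd (QuotientAddGroup.mk x))
  · obtain ⟨l, hl⟩ := exists_linear_of_character
      (χ := fun x : V => χ (.ofAdd (QuotientAddGroup.mk x)))
      (χ.continuous_toFun.comp continuous_quot_mk) fun x y => by
        rw [← map_mul, ← ofAdd_add, QuotientAddGroup.mk_add]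
    obtain ⟨l', hl'⟩ := exists_dualExt_eq L (l := l) fun m => by
      refine exists_int_of_circleExp_eq_one ?_
      rw [← hl, (QuotientAddGroup.eq_zero_iff (m : V)).mpr m.2]
      exact map_one χ
    refine ⟨.ofAdd l', CharTorus.ext_mk fun x => ?_⟩
    rw [hl, ← hl']
    rfl

/-! ### Automorphisms of the unit object -/

/-- The pairs `(0, 2 l)`. -/
def evenPair (L : Type*) [AddCommGroup L] [Module ℤ L] :
    Multiplicative (Module.Dual ℤ L) →* Multiplicative (parityPairs L) :=
  MonoidHom.mk' (fun l => .ofAdd ⟨(0, 2 • l.toAdd), fun _ _ => rfl, fun m => ⟨l.toAdd m, by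
    simp [two_mul]⟩⟩) fun l l' => by
      refine congrArg Multiplicative.ofAdd (Subtype.ext (Prod.ext (add_zero 0).symm ?_))
      exact smul_add 2 l.toAdd l'.toAdd

theorem pointedMapHom_evenPair (l : Multiplicative (Module.Dual ℤ L)) (x : V) :
    parityPairs.pointedMapHom n J (evenPair L l) (.ofAdd x) =
      (1, Circle.exp (2 * Real.pi * dualExt L l.toAdd x)) := by
  refine (parityPairs.pointedMapHom_apply _ _ _ _).trans ?_
  refine congrArg (fun t => ((1 : Multiplicative L), Circle.exp (2 * Real.pi * t))) ?_
  change (formExt L 0 x x + dualExt L (2 • l.toAdd) x) / 2 = _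
  rw [formExt_zero, two_smul, dualExt_add]
  simp

theorem XiCover.bd_evenPair {L : Type*} [AddCommGroup L] [Module ℤ L] {J : LinearMap.BilinForm ℤ L}
    (l : Multiplicative (Module.Dual ℤ L)) : (XiCover J).bd (evenPair L l) = 1 := rfl

variable (L J n) in
/-- The homomorphism sending `l` to the pointed map `x ↦ (0, exp (2 π i l(x)))`. -/
noncomputable def dualPointedMap :
    Multiplicative (Module.Dual ℤ L) →* (PointedMap (Theta L n J))ˣ :=
  (XiCover.toWActPlus L J n).hom₁.comp (evenPair L)

theorem dualPointedMap_apply (l : Multiplicative (Module.Dual ℤ L)) (x : V) :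
    (dualPointedMap L J n l).1 (.ofAdd x) = (1, Circle.exp (2 * Real.pi * dualExt L l.toAdd x)) :=
  pointedMapHom_evenPair l x

theorem bd_dualPointedMap (l : Multiplicative (Module.Dual ℤ L)) :
    (wActPlus (Theta L n J)).bd (dualPointedMap L J n l) = 1 :=
  ((XiCover.toWActPlus L J n).bd_hom₁ _).trans (map_one _)

theorem dualPointedMap_injective : Function.Injective (dualPointedMap L J n) := fun l l' h => by
  have h1 := XiCover.toWActPlus_hom₁_injective
    ((XiCover.bd_evenPair (J := J) l).trans (XiCover.bd_evenPair l').symm) h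
  have h2 : 2 • l.toAdd = 2 • l'.toAdd := congrArg (fun p => p.toAdd.1.2) h1
  exact Multiplicative.toAdd.injective (smul_right_injective _ two_ne_zero h2)

/-- An `η` with trivial boundary comes from a parity pair over `1`, so `B = 0` and the parity
condition forces the linear part to be even. Its factor `2` cancels the one half in `halfForm`. -/
theorem exists_dualPointedMap_eq {η : (PointedMap (Theta L n J))ˣ}
    (h : (wActPlus (Theta L n J)).bd η = 1) : ∃ l, dualPointedMap L J n l = η := by
  obtain ⟨p, hp, rfl⟩ := XiCover.exists_of_hom₀_eq_bd (a := (1 : OTilde J))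
    ((map_one _).trans h.symm)
  have hB : p.toAdd.1.1 = 0 := congrArg OTilde.B hp
  have heven : ∀ m, Even (p.toAdd.1.2 m) := fun m => by
    have := p.toAdd.2.2 m
    rwa [hB, LinearMap.zero_apply, LinearMap.zero_apply, zero_add] at this
  choose k hk using heven
  let l : Module.Dual ℤ L := (AddMonoidHom.mk' k fun m m' => by
    have h2 := hk (m + m')
    rw [map_add, hk m, hk m'] at h2
    linarith).toIntLinearMap
  have hl : evenPair L (.ofAdd l) = p :=
    congrArg Multiplicative.ofAdd (Subtype.ext (Prod.ext hB.symm (LinearMap.ext fun m =>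
      (two_smul ℕ (k m)).trans (hk m).symm)))
  exact ⟨.ofAdd l, congrArg (XiCover.toWActPlus L J n).hom₁ hl⟩

end ThetaMain

/-- The hypothesis `∞ ≤ n` leaves exactly `n = ∞` and `n = ω`, the smooth and the real analytic
settings. -/
theorem mainTheorem2 {V : Type u} [NormedAddCommGroup V] [NormedSpace ℝ V] [FiniteDimensional ℝ V]
    (L : Submodule ℤ V) [DiscreteTopology L] [IsZLattice ℝ L] (J : LinearMap.BilinForm ℤ L)
    (n : WithTop ℕ∞) (hn : ∞ ≤ n) :
    (∃ F : (Xi J).CatGroup ⥤ (wActPlus (Theta L n J)).CatGroup,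
      F.IsEquivalence ∧ Nonempty F.Monoidal) ∧
    (∃ e : Skeleton (wActPlus (Theta L n J)).CatGroup ≃* isometryGroup (J + J.flip),
      ∀ (u : (wActPlus (Theta L n J)).CatGroup) (m : L),
        u.of.1.1.f₀ (.ofAdd (m : V)) = .ofAdd (((e (toSkeleton u)).1 m : L) : V)) ∧
    (∃ e : Aut (𝟙_ (wActPlus (Theta L n J)).CatGroup) ≃* CharTorus L,
      ∀ (a : Aut (𝟙_ (wActPlus (Theta L n J)).CatGroup)) (x : V),
        (CrossedModule.CatGroup.label a.hom).1 (.ofAdd x) =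
          (1, e a (.ofAdd (QuotientAddGroup.mk x)))) ∧
    (∃ e : Multiplicative (Module.Dual ℤ L) ≃* CharTorus L,
      ∀ (l : Module.Dual ℤ L) (x : V),
        e (.ofAdd l) (.ofAdd (QuotientAddGroup.mk x)) =
          Circle.exp (2 * Real.pi * dualExt L l x)) := by
  refine ⟨?_, ?_, ?_, exists_dual_mulEquiv⟩
  · have := XiCover.toXi_isEquivalence J
    have := XiCover.toWActPlus_isEquivalence (L := L) (J := J) hn
    exact CategoryTheory.Functor.exists_monoidal_equivalence_of_span
      (XiCover.toXi J).functor (XiCover.toWActPlus L J n).functor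
  · obtain ⟨e, he⟩ := exists_skeleton_mulEquiv (L := L) (J := J) hn
    refine ⟨e, fun u m => ?_⟩
    rw [he]
    exact f₀_coe_eq_isometryHom u.of m
  · exact CrossedModule.CatGroup.exists_aut_mulEquiv_of_rel (dualPointedMap L J n)
      dualPointedMap_injective bd_dualPointedMap (fun _ => exists_dualPointedMap_eq)
      (P := fun η χ => ∀ x : V, η.1 (.ofAdd x) = (1, χ (.ofAdd (QuotientAddGroup.mk x))))
      (exists_dual_mulEquiv.imp fun _ hc l x =>
        (dualPointedMap_apply l x).trans (congrArg (Prod.mk 1) (hc l.toAdd x).symm))
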